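/- **Theorem.** Let $\mu$ be a probability Borel measure on the unit circle $\mathbb T$ that is nontrivial (its support is infinite). Let $\Phi_n$ be its monic orthogonal polynomials, i.e. $\Phi_n$ is monic of degree $n$ and $\int_{\mathbb T}\Phi_n\overline{\Phi_m}\,d\mu=0$ for $n\neq m$, and put $$\Phi_n^*(z)=z^n\overline{\Phi_n(1/\bar z)},\qquad \alpha_n=-\overline{\Phi_{n+1}(0)},\qquad \tau_n=\frac{\Phi_n(1)}{\Phi_n^*(1)},\qquad n\ge 0,$$ $$R_n(z)=\Bigl(\prod_{j=1}^{n}\frac{1-\tau_{j-1}\alpha_{j-1}}{1-\operatorname{Re}(\tau_{j-1}\alpha_{j-1})}\Bigr)\frac{z\Phi_n(z)-\tau_n\Phi_n^*(z)}{z-1},\qquad n\ge 0,$$ so that $R_n$ is a multiple of the Christoffel–Darboux kernel $K_n(1,z)$ of $\mu$. Then there are real sequences $\{c_n\}_{n\ge1}$, $\{d_{n+1}\}_{n\ge1}$ such that, with $R_{-1}=0$ and $R_0=1$, $$R_{n+1}(z)=\bigl[(1+ic_{n+1})z+(1-ic_{n+1})\bigr]R_n(z)-4d_{n+1}zR_{n-1}(z),\qquad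 n\ge 0,\tag{1}$$ and $\{d_{n+1}\}_{n\ge1}$ is a positive chain sequence, i.e. $d_{n+1}=(1-g_n)g_{n+1}$ for $n\ge1$ with some $0\le g_1<1$ and $0<g_n<1$ for $n\ge2$. Now let $\{c_n\}_{n\ge 1}$, $\{d_{n+1}\}_{n\ge 1}$ be the real coefficients in (1), and let $\{q_{n+1}\}_{n\ge1}$ be a scaling sequence for $\{d_{n+1}\}$: $0<q_{n+1}\le1$ for all $n\ge 1$, and $\{d_{n+1}/q_{n+1}\}_{n\ge1}$ is also a positive chain sequence. For $a,b\in\mathbb R$ and $0<q<1$ let $u^{(-)}(a,b,q)<u^{(+)}(a,b,q)$ be the roots of $$(1-q)u^2-(a+b)u+ab-q=0 .$$ For $q=1$ set $u^{(+)}(a,b,1)=+\infty$ if $a+b\ge0$ and $u^{(-)}(a,b,1)=-\infty$ if $a+b\le0$; in the remaining cases $u^{(\pm)}(a,b,1)$ is the root $\frac{ab-1}{a+b}$ of the linear equation. Put $u_{n+1}^{(\pm)}=u^{(\pm)}(c_n,c_{n+1},q_{n+1})$, $n\ge1$, and $$\vartheta_1=2\operatorname{arccot}\Bigl(\sup_{n\ge1}u_{n+1}^{(+)}\Bigr),\qquad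 \vartheta_2=2\operatorname{arccot}\Bigl(\inf_{n\ge1}u_{n+1}^{(-)}\Bigr),$$ where $\operatorname{arccot}:[-\infty,+\infty]\to[0,\pi]$ is the decreasing inverse of the cotangent, with $\operatorname{arccot}(+\infty)=0$ and $\operatorname{arccot}(-\infty)=\pi$; thus $0\le\vartheta_1,\vartheta_2\le2\pi$. If $\vartheta_1<\vartheta_2$, then $$\operatorname{supp}\bigl(\mu-\mu(\{1\})\delta_1\bigr)\subseteq\mathcal A[\vartheta_1,\vartheta_2]=\{e^{i\theta}:\vartheta_1\le\theta\le\vartheta_2\},$$ where $\delta_1$ is the Dirac measure at $z=1$. -/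

import Mathlib

open MeasureTheory Polynomial
open scoped ComplexConjugate

noncomputable section

namespace CircleSupport

/-- The Borel σ-algebra of the unit circle. -/
instance instMeasurableSpaceCircle : MeasurableSpace Circle := borel Circle

instance instBorelSpaceCircle : BorelSpace Circle := ⟨rfl⟩

/-- A measure on the unit circle is nontrivial when its support is an infinite set. -/
def Nontrivial (μ : Measure Circle) : Prop := μ.support.Infinite

/-- The inner product `∫ p(z) conj(q(z)) dμ(z)` of two polynomials on the unit circle. -/
def innerProd (μ : Measure Circle) (p q : ℂ[X]) : ℂ :=
  ∫ z : Circle, p.eval (z : ℂ) * conj (q.eval (z : ℂ)) ∂μ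

/-- The monic orthogonal polynomials `Φ_n` of `μ`, obtained from `1, z, z², …` by the
Gram–Schmidt process (without normalization). -/
def monicOPUC (μ : Measure Circle) (n : ℕ) : ℂ[X] :=
  X ^ n - ∑ k : Fin n,
    C (innerProd μ (X ^ n) (monicOPUC μ k) / innerProd μ (monicOPUC μ k) (monicOPUC μ k)) * monicOPUC μ k
termination_by n
decreasing_by all_goals exact k.2

/-- The reversed polynomial `Φ_n^*(z) = z^n conj(Φ_n(1 / conj z))`: the coefficients are
conjugated and written in the opposite order. -/
def reversedOPUC (μ : Measure Circle) (n : ℕ) : ℂ[X] :=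
  ((monicOPUC μ n).map (starRingEnd ℂ)).reflect n

/-- The Verblunsky coefficients `α_n = -conj(Φ_{n+1}(0))`, `n ≥ 0`. -/
def verblunsky (μ : Measure Circle) (n : ℕ) : ℂ := -conj ((monicOPUC μ (n + 1)).eval 0)

/-- The numbers `τ_n = Φ_n(1) / Φ_n^*(1)`, `n ≥ 0`. -/
def tau (μ : Measure Circle) (n : ℕ) : ℂ := (monicOPUC μ n).eval 1 / (reversedOPUC μ n).eval 1

/-- The monic Christoffel–Darboux kernel polynomials with one variable fixed at `1`,
`P_n(z) = (z Φ_n(z) - τ_n Φ_n^*(z)) / (z - 1)`; the division is exact. -/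
def kernelPoly (μ : Measure Circle) (n : ℕ) : ℂ[X] :=
  (X * monicOPUC μ n - C (tau μ n) * reversedOPUC μ n) /ₘ (X - C 1)

/-- The normalized kernel polynomials
`R_n = (∏_{j=1}^n (1 - τ_{j-1} α_{j-1}) / (1 - Re (τ_{j-1} α_{j-1}))) P_n`. -/
def R (μ : Measure Circle) (n : ℕ) : ℂ[X] :=
  C (∏ j ∈ Finset.range n, (1 - tau μ j * verblunsky μ j) /
      ((1 - (tau μ j * verblunsky μ j).re : ℝ) : ℂ)) * kernelPoly μ n

/-- `{c_n}_{n ≥ 1}` and `{d_{n+1}}_{n ≥ 1}` are the coefficients of the recurrence relation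
`R_{n+1}(z) = [(1 + i c_{n+1}) z + (1 - i c_{n+1})] R_n(z) - 4 d_{n+1} z R_{n-1}(z)`, `n ≥ 0`,
with `R_{-1} = 0`, `R_0 = 1`. The values `c 0`, `d 0`, `d 1` play no role. -/
def IsRecurrenceCoeffs (μ : Measure Circle) (c d : ℕ → ℝ) : Prop :=
  R μ 0 = 1 ∧
  R μ 1 = (C (1 + Complex.I * c 1) * X + C (1 - Complex.I * c 1)) * R μ 0 ∧
  ∀ n : ℕ, 1 ≤ n →
    R μ (n + 1) = (C (1 + Complex.I * c (n + 1)) * X + C (1 - Complex.I * c (n + 1))) * R μ n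
      - C (4 * (d (n + 1) : ℂ)) * X * R μ (n - 1)

/-- `{d_{n+1}}_{n ≥ 1}` is a positive chain sequence: `d_{n+1} = (1 - g_n) g_{n+1}` for some
parameter sequence `{g_n}_{n ≥ 1}`. The values `d 0`, `d 1` play no role. -/
def IsPositiveChainSequence (d : ℕ → ℝ) : Prop :=
  ∃ g : ℕ → ℝ, (0 ≤ g 1 ∧ g 1 < 1) ∧ (∀ n, 2 ≤ n → 0 < g n ∧ g n < 1) ∧
    ∀ n, 1 ≤ n → d (n + 1) = (1 - g n) * g (n + 1)

/-- `{q_{n+1}}_{n ≥ 1}` is a scaling sequence for the positive chain sequence `{d_{n+1}}_{n ≥ 1}`: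
`0 < q_{n+1} ≤ 1`, and `{d_{n+1} / q_{n+1}}` is again a positive chain sequence. -/
def IsScalingSequence (q d : ℕ → ℝ) : Prop :=
  (∀ n, 1 ≤ n → 0 < q (n + 1) ∧ q (n + 1) ≤ 1) ∧ IsPositiveChainSequence (fun n => d n / q n)

/-- The discriminant of `(1 - q) u² - (a + b) u + (a b - q)`. -/
def discr (a b q : ℝ) : ℝ := (a + b) ^ 2 - 4 * (1 - q) * (a * b - q)

/-- The larger root `u⁽⁺⁾(a, b, q)` of `(1 - q) u² - (a + b) u + a b - q` for `0 ≤ q < 1`; for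
`q = 1` it is `+∞` if `a + b ≥ 0`, and the only root of the then linear polynomial otherwise. -/
def uPlus (a b q : ℝ) : EReal :=
  if q = 1 then
    if 0 ≤ a + b then ⊤ else (((a * b - 1) / (a + b) : ℝ) : EReal)
  else (((a + b + √(discr a b q)) / (2 * (1 - q)) : ℝ) : EReal)

/-- The smaller root `u⁽⁻⁾(a, b, q)` of `(1 - q) u² - (a + b) u + a b - q` for `0 ≤ q < 1`; for
`q = 1` it is `-∞` if `a + b ≤ 0`, and the only root of the then linear polynomial otherwise. -/
def uMinus (a b q : ℝ) : EReal :=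
  if q = 1 then
    if a + b ≤ 0 then ⊥ else (((a * b - 1) / (a + b) : ℝ) : EReal)
  else (((a + b - √(discr a b q)) / (2 * (1 - q)) : ℝ) : EReal)

/-- The discriminant is nonnegative, so the roots used in `uPlus` and `uMinus` are real. -/
theorem discr_nonneg (a b q : ℝ) (h0 : 0 ≤ q) (h1 : q ≤ 1) : 0 ≤ discr a b q := by
  have h : discr a b q = (1 - q) * (a - b) ^ 2 + q * (a + b) ^ 2 + 4 * (q * (1 - q)) := by
    unfold discr; ring
  have h2 : 0 ≤ 1 - q := by linarith
  rw [h]; positivity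

/-- The two numbers used in `uPlus` and `uMinus` are the roots of the quadratic polynomial. -/
theorem quadratic_factor (a b q u : ℝ) (h0 : 0 ≤ q) (h1 : q < 1) :
    (1 - q) * u ^ 2 - (a + b) * u + a * b - q =
      (1 - q) * (u - (a + b - √(discr a b q)) / (2 * (1 - q))) *
        (u - (a + b + √(discr a b q)) / (2 * (1 - q))) := by
  have h2 : 1 - q ≠ 0 := by linarith
  have hs := Real.sq_sqrt (discr_nonneg a b q h0 h1.le)
  have hd : discr a b q = (a + b) ^ 2 - 4 * (1 - q) * (a * b - q) := rfl
  generalize √(discr a b q) = s at *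
  field_simp
  linear_combination hs + hd

/-- The decreasing function `arccot : [-∞, +∞] → [0, π]` inverse to the cotangent, with
`arccot (+∞) = 0` and `arccot (-∞) = π`. -/
def arccot (x : EReal) : ℝ :=
  if x = ⊤ then 0 else if x = ⊥ then Real.pi else Real.pi / 2 - Real.arctan x.toReal

/-- `ϑ₁ = 2 arccot (sup_{n ≥ 1} u⁽⁺⁾(c_n, c_{n+1}, q_{n+1}))`. -/
def theta₁ (c q : ℕ → ℝ) : ℝ :=
  2 * arccot (⨆ (n : ℕ) (_ : 1 ≤ n), uPlus (c n) (c (n + 1)) (q (n + 1)))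

/-- `ϑ₂ = 2 arccot (inf_{n ≥ 1} u⁽⁻⁾(c_n, c_{n+1}, q_{n+1}))`. -/
def theta₂ (c q : ℕ → ℝ) : ℝ :=
  2 * arccot (⨅ (n : ℕ) (_ : 1 ≤ n), uMinus (c n) (c (n + 1)) (q (n + 1)))

/-- The closed arc `{e^{iθ} : a ≤ θ ≤ b}`. -/
def closedArc (a b : ℝ) : Set Circle := {z | ∃ θ : ℝ, a ≤ θ ∧ θ ≤ b ∧ z = Circle.exp θ}

end CircleSupport

end

/-! For real b let w_b = 2(b(1 - cos θ) - sin θ) on the circle; for 0 < θ < 2π its sign at e^{iθ} is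
that of b - cot(θ/2). The support statement therefore reduces to ε w_b ≥ 0 μ-almost everywhere, with
ε = 1 at b = sup u⁽⁺⁾ and ε = -1 at b = inf u⁽⁻⁾ when these are finite. By density of Laurent
polynomials (`measure_weight_neg_eq_zero`) it is enough that the form of ε w_b dμ is nonnegative on
polynomials.

This form is diagonalized explicitly. Put ζ = (b + i)/(b - i). Since w_b is a constant times z⁻¹(z -
1)(z - ζ) and (z - 1)R_n is orthogonal to z, …, z^n, the polynomials S_n = (R_{n+1} -
(R_{n+1}(ζ)/R_n(ζ)) R_n)/(z - ζ) are orthogonal for w_b dμ. Up to a factor κ^n, R_n(ζ) is a real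
number V_n with V_{n+2} = ε(b - c_{n+2})V_{n+1} - (b² + 1)d_{n+2}V_n (`IsRecurrenceCoeffs.eval_eq`),
and ε times the value of the form at S_n is a positive multiple of V_{n+1}/V_n
(`form_weight_semidefinite`).

So only V_n > 0 is needed. The comparison principle `recSolution_pos` yields it when ε(b - c_n) > 0
and q_{n+1}(b² + 1) ≤ (b - c_n)(b - c_{n+1}); the second condition says that the quadratic defining
u⁽±⁾ is nonnegative at b.

The recurrence itself results from eliminating Φ_n - τ_nΦ_n^* between two consequences of the Szegő
recurrence. With β_n = τ_nα_n, |β_n| < 1, the chain parameters are |1 - β_n|²/(2(1 - Re β_n)). -/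

noncomputable section

namespace CircleSupport

/-! ### Polynomials as continuous functions on the circle -/

section

/-- The inclusion of the unit circle into the complex plane. -/
def coord : C(Circle, ℂ) := ⟨fun z => (z : ℂ), continuous_subtype_val⟩

/-- The restriction of polynomials to the unit circle. -/
def ev : ℂ[X] →ₐ[ℂ] C(Circle, ℂ) := aeval coord

@[simp] theorem coord_apply (z : Circle) : coord z = (z : ℂ) := rfl

@[simp] theorem ev_apply (p : ℂ[X]) (z : Circle) : ev p z = p.eval (z : ℂ) := by
  induction p using Polynomial.induction_on' with
  | add p q hp hq => simp [hp, hq]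
  | monomial n a => simp [ev, aeval_monomial]

@[simp] theorem ev_X : ev X = coord := by simp [ev]

theorem ev_C (a : ℂ) : ev (C a) = algebraMap ℂ _ a := by simp [ev]

theorem ev_C_mul (a : ℂ) (p : ℂ[X]) : ev (C a * p) = a • ev p := by
  ext z; simp

theorem coord_mul_star : coord * star coord = 1 := by
  ext z
  have h : (z : ℂ) * conj (z : ℂ) = 1 := by
    rw [Complex.mul_conj, Circle.normSq_coe]; simp
  simpa using h

theorem coord_pow_mul_star (n : ℕ) : coord ^ n * star coord ^ n = 1 := by
  rw [← mul_pow, coord_mul_star, one_pow]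

/-- Holds because conj z = 1/z on the circle. It turns every computation with reversed polynomials
into algebra with `star` and `coord_mul_star`. -/
theorem ev_reflect {p : ℂ[X]} {n : ℕ} (h : p.natDegree ≤ n) :
    ev ((p.map (starRingEnd ℂ)).reflect n) = coord ^ n * star (ev p) := by
  ext z
  have hz : (z : ℂ) ≠ 0 := z.coe_ne_zero
  let _ : Invertible (z : ℂ)⁻¹ := invertibleOfNonzero (inv_ne_zero hz)
  have h1 := eval₂_reflect_mul_pow (RingHom.id ℂ) ((z : ℂ)⁻¹) n (p.map (starRingEnd ℂ))
    (by rwa [natDegree_map_eq_of_injective (starRingEnd ℂ).injective])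
  have h2 : ⅟((z : ℂ)⁻¹) = z := by simp
  rw [h2, ← eval, ← eval] at h1
  have h3 : eval ((z : ℂ)⁻¹) (p.map (starRingEnd ℂ)) = conj (p.eval (z : ℂ)) := by
    rw [← Circle.coe_inv, Circle.coe_inv_eq_conj, eval_map, eval₂_at_apply]
  rw [h3] at h1
  simp only [ev_apply, ContinuousMap.mul_apply, ContinuousMap.pow_apply, coord_apply,
    ContinuousMap.star_apply]
  change _ = _ * conj _
  rw [← h1, mul_comm, mul_assoc, ← mul_pow, inv_mul_cancel₀ hz, one_pow, mul_one]

theorem ev_injective : Function.Injective ev := by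
  intro p q h
  refine Polynomial.eq_of_infinite_eval_eq p q ?_
  have hc : (Set.range (fun z : Circle => (z : ℂ))).Infinite := by
    have : Infinite Circle := by
      refine Set.infinite_univ_iff.1 (Set.Infinite.mono (s := Circle.exp '' Set.Ioc (-Real.pi) Real.pi)
        (Set.subset_univ _) (Set.Infinite.image ?_ (Set.Ioc_infinite (by linarith [Real.pi_pos]))))
      exact fun x hx y hy h => by
        rw [← Circle.arg_exp hx.1 hx.2, ← Circle.arg_exp hy.1 hy.2, h]
    exact Set.infinite_range_of_injective Circle.coe_injective
  refine hc.mono ?_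
  rintro _ ⟨z, rfl⟩
  have := DFunLike.congr_fun h z
  rwa [ev_apply, ev_apply] at this

variable (μ : Measure Circle) [IsProbabilityMeasure μ]

theorem integrable_continuousMap (f : C(Circle, ℂ)) : Integrable (fun z => f z) μ :=
  f.continuous.integrable_of_hasCompactSupport (HasCompactSupport.of_compactSpace _)

/-- Integration of continuous functions. -/
def functional : C(Circle, ℂ) →ₗ[ℂ] ℂ where
  toFun f := ∫ z, f z ∂μ
  map_add' f g := integral_add (integrable_continuousMap μ f) (integrable_continuousMap μ g)
  map_smul' a _ := integral_const_mul a _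

theorem functional_apply (f : C(Circle, ℂ)) : functional μ f = ∫ z, f z ∂μ := rfl

theorem functional_star (f : C(Circle, ℂ)) : functional μ (star f) = conj (functional μ f) :=
  integral_conj

theorem functional_one : functional μ 1 = 1 := by simp [functional_apply]

theorem innerProd_eq (p q : ℂ[X]) : innerProd μ p q = functional μ (ev p * star (ev q)) := by
  simp [functional_apply, innerProd]

theorem functional_mul_star_self (f : C(Circle, ℂ)) :
    functional μ (f * star f) = ((∫ z, ‖f z‖ ^ 2 ∂μ : ℝ) : ℂ) := by
  rw [functional_apply, ← integral_complex_ofReal]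
  congr 1; ext z
  simpa using Complex.mul_conj' (f z)

/-- A zero integral would make p vanish on the support of μ, which is infinite. -/
theorem normSq_integral_pos {μ : Measure Circle} [IsProbabilityMeasure μ] (hμ : Nontrivial μ)
    {p : ℂ[X]} (hp : p ≠ 0) : 0 < ∫ z, ‖ev p z‖ ^ 2 ∂μ := by
  refine lt_of_le_of_ne (integral_nonneg fun z => by positivity) fun h => hp ?_
  have hcont : Continuous fun z => ‖ev p z‖ ^ 2 := by fun_prop
  have h0 := (integral_eq_zero_iff_of_nonneg (fun z => by positivity)
    (hcont.integrable_of_hasCompactSupport (HasCompactSupport.of_compactSpace _))).1 h.symm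
  have hsub : μ.support ⊆ {z | ev p z = 0} :=
    Measure.support_subset_of_isClosed (isClosed_eq (by fun_prop) continuous_const) (by
      filter_upwards [h0] with z hz
      simpa using hz)
  refine Polynomial.eq_zero_of_infinite_isRoot p ?_
  refine (hμ.image (f := (fun z : Circle => (z : ℂ))) Circle.coe_injective.injOn).mono ?_
  rintro _ ⟨z, hz, rfl⟩
  have : ev p z = 0 := hsub hz
  rwa [ev_apply] at this

theorem innerProd_self_ne_zero {μ : Measure Circle} [IsProbabilityMeasure μ] (hμ : Nontrivial μ)
    {p : ℂ[X]} (hp : p ≠ 0) : innerProd μ p p ≠ 0 := by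
  rw [innerProd_eq, functional_mul_star_self]
  exact_mod_cast (normSq_integral_pos hμ hp).ne'

end

/-! ### Orthogonality and the Szegő recurrence -/

section

variable (μ : Measure Circle) [IsProbabilityMeasure μ]

/-- The sesquilinear form on polynomials with weight `w`. -/
def form (w : C(Circle, ℂ)) (p q : ℂ[X]) : ℂ := functional μ (w * ev p * star (ev q))

variable {μ} {w : C(Circle, ℂ)}

theorem innerProd_eq_form (p q : ℂ[X]) : innerProd μ p q = form μ 1 p q := by
  rw [innerProd_eq, form, one_mul]

theorem form_sub_left (p p' q : ℂ[X]) : form μ w (p - p') q = form μ w p q - form μ w p' q := by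
  rw [form, form, form, ← map_sub, map_sub, mul_sub, sub_mul]

theorem form_sub_right (p q q' : ℂ[X]) : form μ w p (q - q') = form μ w p q - form μ w p q' := by
  rw [form, form, form, ← map_sub, map_sub, star_sub, mul_sub]

theorem form_C_mul_left (a : ℂ) (p q : ℂ[X]) : form μ w (C a * p) q = a * form μ w p q := by
  rw [form, form, ev_C_mul, mul_smul_comm, smul_mul_assoc, map_smul, smul_eq_mul]

theorem form_C_mul_right (a : ℂ) (p q : ℂ[X]) :
    form μ w p (C a * q) = conj a * form μ w p q := by
  rw [form, form, ev_C_mul, star_smul, mul_smul_comm, map_smul, smul_eq_mul]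
  rfl

theorem form_sum_left {ι : Type*} (s : Finset ι) (f : ι → ℂ[X]) (q : ℂ[X]) :
    form μ w (∑ i ∈ s, f i) q = ∑ i ∈ s, form μ w (f i) q := by
  simp only [form, map_sum, Finset.mul_sum, Finset.sum_mul]

theorem form_conj (hw : star w = w) (p q : ℂ[X]) : conj (form μ w p q) = form μ w q p := by
  rw [form, form, ← functional_star, star_mul, star_mul, star_star, hw]
  congr 1
  ring

theorem form_X_mul_X_mul (p q : ℂ[X]) : form μ w (X * p) (X * q) = form μ w p q := by
  rw [form, form, map_mul ev, map_mul ev, star_mul, ev_X]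
  congr 1
  linear_combination (w * ev p * star (ev q)) * coord_mul_star

theorem degree_sub_C_mul_lt {N : ℕ} {p q : ℂ[X]} {a : ℂ} (hq : q.degree < (N + 1 : ℕ))
    (hp : p.natDegree ≤ N) (h : q.coeff N = a * p.coeff N) : (q - C a * p).degree < N := by
  rw [degree_lt_iff_coeff_zero] at hq ⊢
  intro m hm
  rcases hm.eq_or_lt with rfl | hm
  · simp [h]
  · rw [coeff_sub, coeff_C_mul, hq m hm, coeff_eq_zero_of_natDegree_lt (hp.trans_lt hm)]
    simp

omit [IsProbabilityMeasure μ] in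
theorem monicOPUC_spec (n : ℕ) : (monicOPUC μ n).Monic ∧ (monicOPUC μ n).natDegree = n := by
  induction n using Nat.strong_induction_on with
  | _ n ih =>
    have hlt : (∑ k : Fin n, C (innerProd μ (X ^ n) (monicOPUC μ k) /
        innerProd μ (monicOPUC μ k) (monicOPUC μ k)) * monicOPUC μ k).degree
        < (X ^ n : ℂ[X]).degree := by
      rw [degree_X_pow]
      refine (degree_sum_le _ _).trans_lt ((Finset.sup_lt_iff (WithBot.bot_lt_coe n)).2 ?_)
      intro k _
      rw [← smul_eq_C_mul]
      refine (degree_smul_le _ _).trans_lt ?_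
      rw [degree_eq_natDegree (ih k k.2).1.ne_zero, (ih k k.2).2]
      exact Nat.cast_lt.2 k.2
    rw [monicOPUC]
    refine ⟨(monic_X_pow n).sub_of_left hlt, natDegree_eq_of_degree_eq_some ?_⟩
    rw [degree_sub_eq_left_of_degree_lt hlt, degree_X_pow]

omit [IsProbabilityMeasure μ] in
theorem monic_monicOPUC (n : ℕ) : (monicOPUC μ n).Monic := (monicOPUC_spec n).1

omit [IsProbabilityMeasure μ] in
theorem natDegree_monicOPUC (n : ℕ) : (monicOPUC μ n).natDegree = n := (monicOPUC_spec n).2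

omit [IsProbabilityMeasure μ] in
theorem coeff_monicOPUC (n : ℕ) : (monicOPUC μ n).coeff n = 1 := by
  have := (monic_monicOPUC (μ := μ) n).coeff_natDegree
  rwa [natDegree_monicOPUC] at this

theorem form_monicOPUC_of_lt (hμ : Nontrivial μ) {n m : ℕ} (h : m < n) :
    form μ 1 (monicOPUC μ n) (monicOPUC μ m) = 0 := by
  induction n using Nat.strong_induction_on generalizing m with
  | _ n ih =>
    rw [monicOPUC, form_sub_left, form_sum_left, sub_eq_zero, Finset.sum_eq_single ⟨m, h⟩]
    · have := innerProd_self_ne_zero hμ (monic_monicOPUC (μ := μ) m).ne_zero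
      rw [form_C_mul_left, ← innerProd_eq_form, ← innerProd_eq_form]
      field_simp
    · intro k _ hk
      have hk' : (k : ℕ) ≠ m := fun h' => hk (Fin.ext h')
      rw [form_C_mul_left]
      rcases hk'.lt_or_gt with hlt | hlt
      · rw [← form_conj (star_one _), ih m h hlt, map_zero, mul_zero]
      · rw [ih k k.2 hlt, mul_zero]
    · simp

/-- Leading terms are stripped off one at a time. The family Φ is left general because it is used
both for the orthogonal polynomials and for the powers of X. -/
theorem form_eq_zero_of_degree_lt {Φ : ℕ → ℂ[X]} (hdeg : ∀ k, (Φ k).natDegree ≤ k)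
    (hcoeff : ∀ k, (Φ k).coeff k = 1) {p : ℂ[X]} {n : ℕ} (h : ∀ k < n, form μ w p (Φ k) = 0)
    {q : ℂ[X]} (hq : q.degree < n) : form μ w p q = 0 := by
  suffices H : ∀ N ≤ n, ∀ q : ℂ[X], q.degree < N → form μ w p q = 0 from H n le_rfl q hq
  intro N
  induction N with
  | zero =>
    intro _ q hq
    have : q = 0 := by
      rw [← degree_eq_bot]
      exact Nat.WithBot.lt_zero_iff.1 (by exact_mod_cast hq)
    simp [this, form]
  | succ N ih =>
    intro hN q hq
    have h1 := ih (Nat.le_of_succ_le hN) (q - C (q.coeff N) * Φ N)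
      (degree_sub_C_mul_lt hq (hdeg N) (by simp [hcoeff]))
    rwa [form_sub_right, form_C_mul_right, h N hN, mul_zero, sub_zero] at h1

theorem form_monicOPUC_of_degree_lt (hμ : Nontrivial μ) {n : ℕ} {q : ℂ[X]} (h : q.degree < n) :
    form μ 1 (monicOPUC μ n) q = 0 :=
  form_eq_zero_of_degree_lt (fun k => (natDegree_monicOPUC k).le) coeff_monicOPUC
    (fun _ hk => form_monicOPUC_of_lt hμ hk) h

omit [IsProbabilityMeasure μ] in
theorem ev_reversedOPUC (n : ℕ) :
    ev (reversedOPUC μ n) = coord ^ n * star (ev (monicOPUC μ n)) :=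
  ev_reflect (natDegree_monicOPUC n).le

theorem natDegree_reflect_map_le {p : ℂ[X]} {n : ℕ} (h : p.natDegree ≤ n) :
    ((p.map (starRingEnd ℂ)).reflect n).natDegree ≤ n :=
  (natDegree_reflect_le ..).trans (max_le le_rfl (natDegree_map_le.trans h))

omit [IsProbabilityMeasure μ] in
theorem natDegree_reversedOPUC_le (n : ℕ) : (reversedOPUC μ n).natDegree ≤ n :=
  natDegree_reflect_map_le (natDegree_monicOPUC n).le

omit [IsProbabilityMeasure μ] in
theorem coeff_zero_reversedOPUC (n : ℕ) : (reversedOPUC μ n).coeff 0 = 1 := by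
  rw [reversedOPUC, coeff_reflect, revAt_le (Nat.zero_le n), coeff_map, Nat.sub_zero,
    coeff_monicOPUC, map_one]

/-- For n = m + 1, z^{m+1} conj(Φ_n) conj(z q) = (z^m conj q) conj(Φ_n), and z^m conj q is a
polynomial of degree at most m, to which Φ_n is orthogonal. -/
theorem form_reversedOPUC_X_mul (hμ : Nontrivial μ) {n : ℕ} {q : ℂ[X]} (h : q.degree < n) :
    form μ 1 (reversedOPUC μ n) (X * q) = 0 := by
  rcases n with _ | m
  · have : q = 0 := by
      rw [← degree_eq_bot]
      exact Nat.WithBot.lt_zero_iff.1 (by exact_mod_cast h)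
    simp [this, form]
  · have hq : q.natDegree ≤ m := by
      by_cases h0 : q = 0
      · simp [h0]
      · exact Nat.lt_succ_iff.1 ((natDegree_lt_iff_degree_lt h0).2 h)
    have h1 : form μ 1 (monicOPUC μ (m + 1)) ((q.map (starRingEnd ℂ)).reflect m) = 0 := by
      refine form_monicOPUC_of_degree_lt hμ (degree_le_natDegree.trans_lt ?_)
      exact_mod_cast Nat.lt_succ_of_le (natDegree_reflect_map_le hq)
    rw [← form_conj (star_one _), map_eq_zero] at h1
    rw [← h1, form, form, ev_reversedOPUC, ev_reflect hq, map_mul ev, star_mul, ev_X]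
    congr 1
    linear_combination (coord ^ m * star (ev q) * star (ev (monicOPUC μ (m + 1)))) * coord_mul_star

/-- The Szegő recurrence. -/
theorem monicOPUC_succ (hμ : Nontrivial μ) (n : ℕ) :
    monicOPUC μ (n + 1) = X * monicOPUC μ n - C (conj (verblunsky μ n)) * reversedOPUC μ n := by
  have hα : conj (verblunsky μ n) = -(monicOPUC μ (n + 1)).eval 0 := by simp [verblunsky]
  -- D has degree at most n and vanishes at 0, so D = zE with deg E < n. Each of its three terms is
  -- orthogonal to zE, hence D is orthogonal to itself.
  set D := monicOPUC μ (n + 1) - X * monicOPUC μ n - C (-conj (verblunsky μ n)) * reversedOPUC μ n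
    with hD
  suffices h : D = 0 by
    rw [hD, C_neg] at h
    linear_combination h
  have hdeg : D.degree < (n + 1 : ℕ) := by
    rw [degree_lt_iff_coeff_zero]
    intro m hm
    rw [hD, coeff_sub, coeff_sub, coeff_C_mul, coeff_eq_zero_of_natDegree_lt
      ((natDegree_reversedOPUC_le n).trans_lt hm)]
    obtain ⟨k, rfl⟩ := Nat.exists_eq_add_of_le' hm
    rw [show k + (n + 1) = (k + n) + 1 by ring, coeff_X_mul]
    rcases k.eq_zero_or_pos with rfl | hk
    · rw [zero_add, coeff_monicOPUC, coeff_monicOPUC]; simp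
    · rw [coeff_eq_zero_of_natDegree_lt (by rw [natDegree_monicOPUC]; lia),
        coeff_eq_zero_of_natDegree_lt (by rw [natDegree_monicOPUC]; lia)]
      simp
  obtain ⟨E, hE⟩ : X ∣ D := by
    rw [X_dvd_iff, hD, coeff_sub, coeff_sub, coeff_C_mul, coeff_zero_reversedOPUC, hα,
      coeff_zero_eq_eval_zero, mul_coeff_zero]
    simp
  have hEdeg : E.degree < n := by
    rw [degree_lt_iff_coeff_zero] at hdeg ⊢
    intro m hm
    have := hdeg (m + 1) (by lia)
    rwa [hE, coeff_X_mul] at this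
  by_contra h0
  refine innerProd_self_ne_zero hμ h0 ?_
  rw [innerProd_eq_form]
  nth_rewrite 2 [hE]
  rw [hD, form_sub_left, form_sub_left, form_C_mul_left, form_reversedOPUC_X_mul hμ hEdeg,
    form_X_mul_X_mul, form_monicOPUC_of_degree_lt hμ hEdeg,
    form_monicOPUC_of_degree_lt hμ (by rwa [← hE])]
  simp

theorem reversedOPUC_succ (hμ : Nontrivial μ) (n : ℕ) :
    reversedOPUC μ (n + 1) = reversedOPUC μ n - C (verblunsky μ n) * (X * monicOPUC μ n) := by
  apply ev_injective
  have hs : star (ev (C (conj (verblunsky μ n)))) = ev (C (verblunsky μ n)) := by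
    ext z
    simp
  rw [ev_reversedOPUC, monicOPUC_succ hμ, map_sub, map_sub, map_mul, map_mul, map_mul, map_mul,
    star_sub, star_mul, star_mul, hs, ev_reversedOPUC, star_mul, star_pow, star_star, ev_X]
  linear_combination (coord ^ n * star (ev (monicOPUC μ n))) * coord_mul_star -
    (coord * ev (monicOPUC μ n) * ev (C (verblunsky μ n))) * coord_pow_mul_star n

/-- Pythagoras in zΦ_n = Φ_{n+1} + conj(α_n)Φ_n^*, where zΦ_n, Φ_n and Φ_n^* have equal norms:
‖Φ_{n+1}‖² = (1 - |α_n|²)‖Φ_n‖². -/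
theorem norm_verblunsky_lt_one (hμ : Nontrivial μ) (n : ℕ) : ‖verblunsky μ n‖ < 1 := by
  have h1 := form_X_mul_X_mul (μ := μ) (w := 1) (monicOPUC μ n) (monicOPUC μ n)
  have hX : X * monicOPUC μ n =
      monicOPUC μ (n + 1) - C (-conj (verblunsky μ n)) * reversedOPUC μ n := by
    rw [monicOPUC_succ hμ n, C_neg]; ring
  have h2 : form μ 1 (monicOPUC μ (n + 1)) (reversedOPUC μ n) = 0 := by
    refine form_monicOPUC_of_degree_lt hμ (degree_le_natDegree.trans_lt ?_)
    exact_mod_cast Nat.lt_succ_of_le (natDegree_reversedOPUC_le n)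
  have h3 : form μ 1 (reversedOPUC μ n) (monicOPUC μ (n + 1)) = 0 := by
    rw [← form_conj (star_one _), h2, map_zero]
  have h4 : form μ 1 (reversedOPUC μ n) (reversedOPUC μ n) =
      form μ 1 (monicOPUC μ n) (monicOPUC μ n) := by
    rw [form, form, ev_reversedOPUC, star_mul, star_pow, star_star]
    congr 1
    linear_combination (star (ev (monicOPUC μ n)) * ev (monicOPUC μ n)) * coord_pow_mul_star n
  rw [hX, form_sub_left, form_sub_right, form_sub_right, form_C_mul_left, form_C_mul_left,
    form_C_mul_right, form_C_mul_right, h2, h3, h4, ← innerProd_eq_form, ← innerProd_eq_form,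
    innerProd_eq, innerProd_eq, functional_mul_star_self, functional_mul_star_self] at h1
  have p1 := normSq_integral_pos hμ (monic_monicOPUC (μ := μ) n).ne_zero
  have p2 := normSq_integral_pos hμ (monic_monicOPUC (μ := μ) (n + 1)).ne_zero
  generalize (∫ z, ‖ev (monicOPUC μ n) z‖ ^ 2 ∂μ) = N at *
  generalize (∫ z, ‖ev (monicOPUC μ (n + 1)) z‖ ^ 2 ∂μ) = M at *
  have h5 : ((M + ‖verblunsky μ n‖ ^ 2 * N : ℝ) : ℂ) = (N : ℝ) := by
    push_cast
    rw [← Complex.mul_conj']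
    simp only [map_neg, Complex.conj_conj] at h1
    linear_combination h1
  have h6 : M + ‖verblunsky μ n‖ ^ 2 * N = N := by exact_mod_cast h5
  by_contra! h
  nlinarith [mul_nonneg (sub_nonneg.2 (one_le_pow₀ h (n := 2))) p1.le]

omit [IsProbabilityMeasure μ] in
theorem eval_one_reversedOPUC (n : ℕ) :
    (reversedOPUC μ n).eval 1 = conj ((monicOPUC μ n).eval 1) := by
  have := DFunLike.congr_fun (ev_reversedOPUC (μ := μ) n) 1
  simpa using this

/-- At z = 1, |Φ_n^*| = |Φ_n|; so Φ_{n+1}(1) = 0 would force |Φ_n(1)| = |α_n||Φ_n(1)|. -/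
theorem eval_one_monicOPUC_ne_zero (hμ : Nontrivial μ) (n : ℕ) :
    (monicOPUC μ n).eval 1 ≠ 0 := by
  induction n with
  | zero => rw [monicOPUC]; simp
  | succ n ih =>
    intro h
    rw [monicOPUC_succ hμ, eval_sub, eval_mul, eval_mul, eval_C, eval_X, one_mul,
      eval_one_reversedOPUC, sub_eq_zero] at h
    have h1 := congrArg norm h
    rw [norm_mul, Complex.norm_conj, Complex.norm_conj] at h1
    have h2 := norm_verblunsky_lt_one hμ n
    have h3 := norm_pos_iff.2 ih
    nlinarith

theorem tau_mul_conj (hμ : Nontrivial μ) (n : ℕ) : tau μ n * conj (tau μ n) = 1 := by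
  have h := eval_one_monicOPUC_ne_zero hμ n
  have h' : conj ((monicOPUC μ n).eval 1) ≠ 0 := by simpa using h
  rw [tau, eval_one_reversedOPUC, map_div₀, Complex.conj_conj]
  field_simp

end

/-! ### Kernel polynomials, their three-term recurrence and the chain sequence -/

section

variable {μ : Measure Circle} [IsProbabilityMeasure μ]

theorem X_sub_one_mul_kernelPoly (hμ : Nontrivial μ) (n : ℕ) :
    (X - C 1) * kernelPoly μ n = X * monicOPUC μ n - C (tau μ n) * reversedOPUC μ n := by
  rw [kernelPoly, mul_divByMonic_eq_iff_isRoot, IsRoot, eval_sub, eval_mul, eval_mul, eval_X,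
    eval_C, tau, div_mul_cancel₀, one_mul, sub_self]
  rw [eval_one_reversedOPUC]
  simpa using eval_one_monicOPUC_ne_zero hμ n

/-- The modified Verblunsky coefficients `τ_n α_n`. -/
def modVerblunsky (μ : Measure Circle) (n : ℕ) : ℂ := tau μ n * verblunsky μ n

theorem norm_modVerblunsky_lt_one (hμ : Nontrivial μ) (n : ℕ) : ‖modVerblunsky μ n‖ < 1 := by
  have h : ‖tau μ n‖ = 1 := by
    have := tau_mul_conj hμ n
    rw [Complex.mul_conj'] at this
    have h2 : ‖tau μ n‖ ^ 2 = 1 := by exact_mod_cast this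
    exact (pow_eq_one_iff_of_nonneg (norm_nonneg _) two_ne_zero).1 h2
  rw [modVerblunsky, norm_mul, h, one_mul]
  exact norm_verblunsky_lt_one hμ n

theorem one_sub_re_modVerblunsky_pos (hμ : Nontrivial μ) (n : ℕ) :
    0 < 1 - (modVerblunsky μ n).re := by
  have := Complex.re_le_norm (modVerblunsky μ n)
  have := norm_modVerblunsky_lt_one hμ n
  linarith

theorem one_sub_modVerblunsky_ne_zero (hμ : Nontrivial μ) (n : ℕ) :
    1 - modVerblunsky μ n ≠ 0 := by
  intro h
  have h1 := one_sub_re_modVerblunsky_pos hμ n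
  have h2 := congrArg Complex.re h
  simp only [Complex.sub_re, Complex.one_re, Complex.zero_re] at h2
  linarith

theorem tau_succ (hμ : Nontrivial μ) (n : ℕ) :
    tau μ (n + 1) * (1 - tau μ n * verblunsky μ n) = tau μ n - conj (verblunsky μ n) := by
  have h := eval_one_monicOPUC_ne_zero hμ n
  have h' : (reversedOPUC μ n).eval 1 ≠ 0 := by
    rw [eval_one_reversedOPUC]; simpa using h
  have h1 := eval_one_monicOPUC_ne_zero hμ (n + 1)
  have h2 : (reversedOPUC μ (n + 1)).eval 1 ≠ 0 := by
    rw [eval_one_reversedOPUC]; simpa using h1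
  have h3 := congrArg (eval 1) (monicOPUC_succ hμ n)
  have h4 := congrArg (eval 1) (reversedOPUC_succ hμ n)
  simp only [eval_sub, eval_mul, eval_C, eval_X, one_mul] at h3 h4
  rw [tau, tau]
  field_simp
  rw [h3, h4]
  ring

/-- This and the next identity both involve the combination Φ - τΦ^*; eliminating it gives the
three-term recurrence `kernelPoly_add_two`. Both are the Szegő recurrence combined with `tau_succ`
and |τ_n| = 1. -/
theorem kernelPoly_succ_aux (hμ : Nontrivial μ) (n : ℕ) :
    C (1 - modVerblunsky μ n) * ((X - C 1) * kernelPoly μ (n + 1)) =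
      (C (1 - modVerblunsky μ n) * X + C (1 - conj (modVerblunsky μ n))) *
        ((X - C 1) * kernelPoly μ n) -
      C ((1 - modVerblunsky μ n) * (1 - conj (modVerblunsky μ n))) * X *
        (monicOPUC μ n - C (tau μ n) * reversedOPUC μ n) := by
  have e1 := congrArg C (tau_succ hμ n)
  have e2 := congrArg C (tau_mul_conj hμ n)
  rw [X_sub_one_mul_kernelPoly hμ, X_sub_one_mul_kernelPoly hμ, monicOPUC_succ hμ,
    reversedOPUC_succ hμ]
  simp only [modVerblunsky, map_mul, map_sub, map_one] at e1 e2 ⊢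
  linear_combination
    (-(reversedOPUC μ n - C (verblunsky μ n) * X * monicOPUC μ n)) * e1 +
    (reversedOPUC μ n * ((1 - C (tau μ n) * C (verblunsky μ n)) * X * C (conj (verblunsky μ n)) -
      C (conj (verblunsky μ n))) +
      monicOPUC μ n * X * C (verblunsky μ n) * C (conj (verblunsky μ n))) * e2

theorem monicOPUC_succ_sub_tau_mul_reversedOPUC_succ (hμ : Nontrivial μ) (n : ℕ) :
    C (1 - modVerblunsky μ n) * (monicOPUC μ (n + 1) - C (tau μ (n + 1)) * reversedOPUC μ (n + 1)) =
      C (1 - modVerblunsky μ n * conj (modVerblunsky μ n)) * ((X - C 1) * kernelPoly μ n) := by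
  have e1 := congrArg C (tau_succ hμ n)
  have e2 := congrArg C (tau_mul_conj hμ n)
  rw [X_sub_one_mul_kernelPoly hμ, monicOPUC_succ hμ, reversedOPUC_succ hμ]
  simp only [modVerblunsky, map_mul, map_sub, map_one] at e1 e2 ⊢
  linear_combination
    (-(reversedOPUC μ n - C (verblunsky μ n) * X * monicOPUC μ n)) * e1 +
    (X * monicOPUC μ n * C (verblunsky μ n) * C (conj (verblunsky μ n)) -
      C (tau μ n) * C (verblunsky μ n) * C (conj (verblunsky μ n)) * reversedOPUC μ n) * e2

theorem kernelPoly_zero (hμ : Nontrivial μ) : kernelPoly μ 0 = 1 := by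
  have h0 : monicOPUC μ 0 = 1 := by rw [monicOPUC]; simp
  have h1 : reversedOPUC μ 0 = 1 := by simp [reversedOPUC, h0]
  have ht : tau μ 0 = 1 := by simp [tau, h0, h1]
  have h := X_sub_one_mul_kernelPoly hμ 0
  rw [h0, h1, ht] at h
  exact mul_left_cancel₀ (X_sub_C_ne_zero 1) (by linear_combination h)

theorem kernelPoly_one (hμ : Nontrivial μ) :
    C (1 - modVerblunsky μ 0) * kernelPoly μ 1 =
      C (1 - modVerblunsky μ 0) * X + C (1 - conj (modVerblunsky μ 0)) := by
  have h0 : monicOPUC μ 0 = 1 := by rw [monicOPUC]; simp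
  have h1 : reversedOPUC μ 0 = 1 := by simp [reversedOPUC, h0]
  have ht : tau μ 0 = 1 := by simp [tau, h0, h1]
  have h := kernelPoly_succ_aux hμ 0
  rw [h0, h1, ht, kernelPoly_zero hμ, C_1, zero_add] at h
  exact mul_left_cancel₀ (X_sub_C_ne_zero 1) (by rw [C_1]; linear_combination h)

theorem kernelPoly_add_two (hμ : Nontrivial μ) (n : ℕ) :
    C ((1 - modVerblunsky μ n) * (1 - modVerblunsky μ (n + 1))) * kernelPoly μ (n + 2) =
      C (1 - modVerblunsky μ n) *
        (C (1 - modVerblunsky μ (n + 1)) * X + C (1 - conj (modVerblunsky μ (n + 1)))) *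
        kernelPoly μ (n + 1) -
      C ((1 - modVerblunsky μ (n + 1)) * (1 - conj (modVerblunsky μ (n + 1))) *
        (1 - modVerblunsky μ n * conj (modVerblunsky μ n))) * X * kernelPoly μ n := by
  refine mul_left_cancel₀ (X_sub_C_ne_zero 1) ?_
  have h1 := kernelPoly_succ_aux hμ (n + 1)
  have h2 := monicOPUC_succ_sub_tau_mul_reversedOPUC_succ hμ n
  rw [C_mul, C_mul (b := 1 - modVerblunsky μ n * conj (modVerblunsky μ n))]
  linear_combination C (1 - modVerblunsky μ n) * h1 -
    C ((1 - modVerblunsky μ (n + 1)) * (1 - conj (modVerblunsky μ (n + 1)))) * X * h2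

/-- The coefficients `c_{n+1} = -Im β_n / (1 - Re β_n)`, where `β_n = τ_n α_n`. -/
def recC (μ : Measure Circle) (n : ℕ) : ℝ :=
  -(modVerblunsky μ (n - 1)).im / (1 - (modVerblunsky μ (n - 1)).re)

/-- The parameters `g_{n+1} = |1 - β_n|² / (2 (1 - Re β_n))`, where `β_n = τ_n α_n`. -/
def recG (μ : Measure Circle) (n : ℕ) : ℝ :=
  ‖1 - modVerblunsky μ (n - 1)‖ ^ 2 / (2 * (1 - (modVerblunsky μ (n - 1)).re))

/-- From |1 - β|² + (1 - |β|²) = 2(1 - Re β). Together with |β| < 1 this places the parameters in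
(0, 1). -/
theorem one_sub_recG (hμ : Nontrivial μ) (n : ℕ) :
    1 - recG μ (n + 1) =
      (1 - ‖modVerblunsky μ n‖ ^ 2) / (2 * (1 - (modVerblunsky μ n).re)) := by
  have h := one_sub_re_modVerblunsky_pos hμ n
  rw [recG, Nat.add_sub_cancel, eq_div_iff (by positivity), sub_mul, div_mul_cancel₀ _ (by positivity),
    ← Complex.normSq_eq_norm_sq, ← Complex.normSq_eq_norm_sq, Complex.normSq_apply,
    Complex.normSq_apply]
  simp
  ring

theorem recG_mem (hμ : Nontrivial μ) (n : ℕ) : 0 < recG μ (n + 1) ∧ recG μ (n + 1) < 1 := by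
  have h := one_sub_re_modVerblunsky_pos hμ n
  constructor
  · have := norm_pos_iff.2 (one_sub_modVerblunsky_ne_zero hμ n)
    rw [recG, Nat.add_sub_cancel]
    positivity
  · have h1 : ‖modVerblunsky μ n‖ ^ 2 < 1 :=
      pow_lt_one₀ (norm_nonneg _) (norm_modVerblunsky_lt_one hμ n) two_ne_zero
    have h2 := one_sub_recG hμ n
    have : 0 < (1 - ‖modVerblunsky μ n‖ ^ 2) / (2 * (1 - (modVerblunsky μ n).re)) :=
      div_pos (by linarith) (by linarith)
    linarith

/-- This explains the normalizing product in `R`: its factors turn 1 - β_n and its conjugate into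
numbers with real part 1. -/
theorem one_add_I_mul_recC (hμ : Nontrivial μ) (n : ℕ) :
    1 + Complex.I * recC μ (n + 1) =
      (1 - modVerblunsky μ n) / ((1 - (modVerblunsky μ n).re : ℝ) : ℂ) := by
  have h := one_sub_re_modVerblunsky_pos hμ n
  have h' : ((1 - (modVerblunsky μ n).re : ℝ) : ℂ) ≠ 0 := by exact_mod_cast h.ne'
  rw [recC, Nat.add_sub_cancel, eq_div_iff h', Complex.ofReal_div, add_mul, mul_assoc,
    div_mul_cancel₀ _ h']
  apply Complex.ext <;> simp

theorem one_sub_I_mul_recC (hμ : Nontrivial μ) (n : ℕ) :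
    1 - Complex.I * recC μ (n + 1) =
      (1 - conj (modVerblunsky μ n)) / ((1 - (modVerblunsky μ n).re : ℝ) : ℂ) := by
  have := congrArg conj (one_add_I_mul_recC hμ n)
  simp only [map_add, map_mul, map_div₀, map_sub, map_one, Complex.conj_I, Complex.conj_ofReal]
    at this
  rw [← this]
  ring

theorem four_mul_recD (hμ : Nontrivial μ) (n : ℕ) :
    4 * (((1 - recG μ (n + 1)) * recG μ (n + 2) : ℝ) : ℂ) =
      (1 - modVerblunsky μ (n + 1)) * (1 - conj (modVerblunsky μ (n + 1))) *
        (1 - modVerblunsky μ n * conj (modVerblunsky μ n)) /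
        (((1 - (modVerblunsky μ n).re : ℝ) : ℂ) * ((1 - (modVerblunsky μ (n + 1)).re : ℝ) : ℂ)) := by
  have h := one_sub_re_modVerblunsky_pos hμ n
  have h1 := one_sub_re_modVerblunsky_pos hμ (n + 1)
  have e1 : (1 - modVerblunsky μ (n + 1)) * (1 - conj (modVerblunsky μ (n + 1))) =
      ((‖1 - modVerblunsky μ (n + 1)‖ ^ 2 : ℝ) : ℂ) := by
    rw [← Complex.normSq_eq_norm_sq, ← Complex.mul_conj, map_sub, map_one]
  have e2 : modVerblunsky μ n * conj (modVerblunsky μ n) = ((‖modVerblunsky μ n‖ ^ 2 : ℝ) : ℂ) := by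
    rw [← Complex.normSq_eq_norm_sq, ← Complex.mul_conj]
  rw [e1, e2, one_sub_recG hμ, recG, show n + 2 - 1 = n + 1 from rfl]
  norm_cast
  field_simp
  ring

omit [IsProbabilityMeasure μ] in
theorem R_succ (n : ℕ) (P : ℂ[X])
    (h : C (1 - modVerblunsky μ n) * kernelPoly μ (n + 1) = P) :
    R μ (n + 1) = C (∏ j ∈ Finset.range n, (1 - tau μ j * verblunsky μ j) /
      ((1 - (tau μ j * verblunsky μ j).re : ℝ) : ℂ)) *
      C (((1 - (modVerblunsky μ n).re : ℝ) : ℂ)⁻¹) * P := by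
  rw [R, Finset.prod_range_succ, ← h, div_eq_mul_inv, C_mul, C_mul, modVerblunsky]
  ring

theorem R_zero (hμ : Nontrivial μ) : R μ 0 = 1 := by simp [R, kernelPoly_zero hμ]

theorem isRecurrenceCoeffs_rec (hμ : Nontrivial μ) :
    IsRecurrenceCoeffs μ (recC μ) (fun n => (1 - recG μ (n - 1)) * recG μ n) := by
  refine ⟨R_zero hμ, ?_, ?_⟩
  · rw [R_succ 0 _ (kernelPoly_one hμ), R_zero hμ, one_add_I_mul_recC hμ, one_sub_I_mul_recC hμ,
      div_eq_mul_inv, div_eq_mul_inv, C_mul, C_mul]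
    simp
    ring
  · intro m hm
    obtain ⟨n, rfl⟩ := Nat.exists_eq_add_of_le' hm
    have h := kernelPoly_add_two hμ n
    have hd := four_mul_recD hμ n
    simp only [Nat.add_sub_cancel] at hd ⊢
    rw [one_add_I_mul_recC hμ, one_sub_I_mul_recC hμ, hd, R, R, R, Finset.prod_range_succ,
      Finset.prod_range_succ]
    simp only [← modVerblunsky.eq_1, div_eq_mul_inv, C_mul, mul_inv] at h ⊢
    linear_combination (C (∏ j ∈ Finset.range n, (1 - modVerblunsky μ j) *
      (((1 - (modVerblunsky μ j).re : ℝ) : ℂ))⁻¹) * C (((1 - (modVerblunsky μ n).re : ℝ) : ℂ)⁻¹) *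
      C (((1 - (modVerblunsky μ (n + 1)).re : ℝ) : ℂ)⁻¹)) * h

theorem isPositiveChainSequence_rec (hμ : Nontrivial μ) :
    IsPositiveChainSequence (fun n => (1 - recG μ (n - 1)) * recG μ n) := by
  refine ⟨recG μ, ⟨(recG_mem hμ 0).1.le, (recG_mem hμ 0).2⟩, ?_, fun n _ => rfl⟩
  intro n hn
  obtain ⟨k, rfl⟩ := Nat.exists_eq_add_of_le' hn
  exact recG_mem hμ (k + 1)

end

/-! ### Comparison for chain sequences; moments and values of R_n -/

section

/-- The solution of `V (n + 2) = y (n + 2) V (n + 1) - e (n + 2) V n`, `V 0 = 1`, `V 1 = y 1`. -/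
def recSolution (y e : ℕ → ℝ) : ℕ → ℝ
  | 0 => 1
  | 1 => y 1
  | n + 2 => y (n + 2) * recSolution y e (n + 1) - e (n + 2) * recSolution y e n

/-- The comparison principle for chain sequences. -/
theorem recSolution_pos {y e g : ℕ → ℝ} (hy : ∀ n, 1 ≤ n → 0 < y n) (hg : ∀ n, 1 ≤ n → 0 ≤ g n ∧ g n < 1)
    (he : ∀ n, 1 ≤ n → e (n + 1) ≤ (1 - g n) * g (n + 1) * (y n * y (n + 1))) (n : ℕ) :
    0 < recSolution y e n := by
  -- Positivity alone does not propagate; the induction carries the lower bound (1 - g_{n+1})y_{n+1}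
  -- for the ratio V_{n+1}/V_n.
  suffices H : 0 < recSolution y e n ∧
      (1 - g (n + 1)) * y (n + 1) * recSolution y e n ≤ recSolution y e (n + 1) from H.1
  induction n with
  | zero =>
    have := hy 1 le_rfl
    simp only [recSolution, zero_add, mul_one, zero_lt_one, true_and]
    nlinarith [hg 1 le_rfl]
  | succ n ih =>
    obtain ⟨h0, h1⟩ := ih
    have hy1 := hy (n + 1) (by lia)
    have hy2 := hy (n + 2) (by lia)
    have hg1 := (hg (n + 1) (by lia)).2
    have hpos : 0 < recSolution y e (n + 1) :=
      (mul_pos (mul_pos (sub_pos.2 hg1) hy1) h0).trans_le h1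
    refine ⟨hpos, ?_⟩
    have h2 := mul_le_mul_of_nonneg_right (he (n + 1) (by lia)) h0.le
    have h3 := mul_le_mul_of_nonneg_left h1 (mul_nonneg (hg (n + 2) (by lia)).1 hy2.le)
    change _ ≤ y (n + 2) * recSolution y e (n + 1) - e (n + 2) * recSolution y e n
    linear_combination h2 + h3

variable {μ : Measure Circle} [IsProbabilityMeasure μ] {c d : ℕ → ℝ}

theorem form_X_sub_one_mul_R (hμ : Nontrivial μ) {n k : ℕ} (h : k < n) :
    form μ 1 ((X - C 1) * R μ n) (X ^ (k + 1)) = 0 := by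
  have hk : (X ^ k : ℂ[X]).degree < n := by
    rw [degree_X_pow]
    exact Nat.cast_lt.2 h
  rw [R, mul_left_comm, X_sub_one_mul_kernelPoly hμ, form_C_mul_left, form_sub_left,
    form_C_mul_left, pow_succ', form_X_mul_X_mul, form_reversedOPUC_X_mul hμ hk,
    form_monicOPUC_of_degree_lt hμ hk]
  simp

omit [IsProbabilityMeasure μ] in
theorem IsRecurrenceCoeffs.add_two (h : IsRecurrenceCoeffs μ c d) (n : ℕ) :
    R μ (n + 2) = (C (1 + Complex.I * c (n + 2)) * X + C (1 - Complex.I * c (n + 2))) * R μ (n + 1)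
      - C (4 * (d (n + 2) : ℂ)) * X * R μ n :=
  h.2.2 (n + 1) (by lia)

omit [IsProbabilityMeasure μ] in
theorem IsRecurrenceCoeffs.degree_coeff (h : IsRecurrenceCoeffs μ c d) (n : ℕ) :
    (R μ n).natDegree ≤ n ∧
      (R μ n).coeff n = ∏ j ∈ Finset.range n, (1 + Complex.I * c (j + 1)) := by
  induction n using Nat.twoStepInduction with
  | zero => simp [h.1]
  | one =>
    rw [h.2.1, h.1, mul_one]
    exact ⟨natDegree_linear_le, by simp [coeff_one]⟩
  | more n ih1 ih2 =>
    rw [h.add_two]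
    constructor
    · refine (natDegree_sub_le _ _).trans (max_le ?_ ?_)
      · exact natDegree_mul_le_of_le natDegree_linear_le ih2.1 |>.trans (by lia)
      · refine (natDegree_mul_le_of_le (natDegree_mul_le_of_le (natDegree_C _).le natDegree_X_le)
          ih1.1).trans (by lia)
    · rw [Finset.prod_range_succ, ← ih2.2, add_mul, mul_assoc, mul_assoc, coeff_sub, coeff_add,
        coeff_C_mul, coeff_C_mul, coeff_C_mul, coeff_X_mul, coeff_X_mul,
        coeff_eq_zero_of_natDegree_lt (p := R μ (n + 1)) (n := n + 2) (by lia),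
        coeff_eq_zero_of_natDegree_lt (p := R μ n) (n := n + 1) (by lia)]
      ring

/-- Pairing the recurrence for (z - 1)R_{n+2} with z^{n+2} leaves two nonzero terms, so these
numbers satisfy r_{n+1} = 4d_{n+2}r_n. -/
theorem IsRecurrenceCoeffs.exists_pos (hμ : Nontrivial μ) (h : IsRecurrenceCoeffs μ c d)
    (hd : ∀ n, 0 < d (n + 2)) (n : ℕ) :
    ∃ r : ℝ, 0 < r ∧ conj ((R μ (n + 1)).coeff (n + 1)) *
      form μ 1 ((X - C 1) * R μ n) (X ^ (n + 1)) = r := by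
  induction n with
  | zero =>
    set s := form μ 1 ((X - C 1) * R μ 0) (X ^ 1) with hs
    have h1 := form_X_sub_one_mul_R hμ zero_lt_one
    have hX : form μ 1 X X = 1 := by
      have := form_X_mul_X_mul (μ := μ) (w := 1) 1 1
      rw [mul_one] at this
      rw [this, form]
      simp [functional_one]
    have h11 : form μ 1 1 1 = 1 := by
      rw [form]
      simp [functional_one]
    have hs1 : s = 1 - form μ 1 1 X := by
      rw [hs, h.1, mul_one, pow_one, C_1, form_sub_left, hX]
    have hs2 : conj s = 1 - form μ 1 X 1 := by
      rw [hs1, map_sub, map_one, form_conj (star_one _)]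
    have h2 : form μ 1 (X - C 1) (X - C 1) = s + conj s := by
      rw [hs1, map_sub, map_one conj, form_conj (star_one _), C_1, form_sub_left, form_sub_right,
        form_sub_right, hX, h11]
      ring
    rw [← innerProd_eq_form, innerProd_eq, functional_mul_star_self, Complex.add_conj] at h2
    have h3 := normSq_integral_pos hμ (X_sub_C_ne_zero 1)
    have h4 : 0 < 2 * s.re := by
      rwa [show (∫ z, ‖ev (X - C 1) z‖ ^ 2 ∂μ) = 2 * s.re by exact_mod_cast h2] at h3
    -- Orthogonality of (z - 1)R_1 to z makes (1 - ic_1)s real; its value is then (1 + c_1²) Re s,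
    -- and 2 Re s = ‖z - 1‖² > 0.
    have h5 : (1 - Complex.I * c 1) * s = (1 + Complex.I * c 1) * conj s := by
      have e : (X - C 1) * R μ 1 = C (1 - Complex.I * c 1) * ((X - C 1) * R μ 0)
          - C (-(1 + Complex.I * c 1)) * (X * (X - C 1)) := by
        rw [h.2.1, h.1, C_neg]; ring
      have e2 : form μ 1 (X * (X - C 1)) (X ^ 1) = - conj s := by
        have := form_X_mul_X_mul (μ := μ) (w := 1) (X - C 1) 1
        rw [mul_one] at this
        rw [pow_one, this, hs2, C_1, form_sub_left, h11]
        ring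
      rw [e, form_sub_left, form_C_mul_left, form_C_mul_left, zero_add, e2, ← hs] at h1
      linear_combination h1
    have h6 : conj ((R μ (0 + 1)).coeff (0 + 1)) = 1 - Complex.I * c 1 := by
      rw [(h.degree_coeff (0 + 1)).2]
      simp [sub_eq_add_neg]
    refine ⟨(1 + c 1 ^ 2) * s.re, by nlinarith [sq_nonneg (c 1)], ?_⟩
    rw [h6]
    have h7 := congrArg Complex.im h5
    simp at h7
    apply Complex.ext <;> simp [pow_two]
    · linear_combination (c 1 / 2) * h7
    · linear_combination h7 / 2
  | succ n ih =>
    obtain ⟨r, hr, hr'⟩ := ih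
    refine ⟨4 * d (n + 2) * r, by have := hd n; positivity, ?_⟩
    have h0 := form_X_sub_one_mul_R hμ (show n + 1 < n + 2 by lia)
    have e : (X - C 1) * R μ (n + 2) = C (1 - Complex.I * c (n + 2)) * ((X - C 1) * R μ (n + 1))
        - C (-(1 + Complex.I * c (n + 2))) * (X * ((X - C 1) * R μ (n + 1))) -
        C (4 * (d (n + 2) : ℂ)) * (X * ((X - C 1) * R μ n)) := by
      rw [h.add_two, C_neg]; ring
    rw [e, form_sub_left, form_sub_left, form_C_mul_left, form_C_mul_left, form_C_mul_left,
      pow_succ' X (n + 1), form_X_mul_X_mul, form_X_mul_X_mul,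
      form_X_sub_one_mul_R hμ (show n < n + 1 by lia), ← pow_succ'] at h0
    rw [(h.degree_coeff _).2, Finset.prod_range_succ, ← (h.degree_coeff _).2, map_mul]
    have h6 : conj (1 + Complex.I * c (n + 1 + 1)) = 1 - Complex.I * c (n + 2) := by
      simp [sub_eq_add_neg]
    rw [h6]
    push_cast
    linear_combination conj ((R μ (n + 1)).coeff (n + 1)) * h0 + 4 * (d (n + 2) : ℂ) * hr'

-- For b = cot(θ/2) the point is e^{iθ}. Dividing by powers of κ = 2ε/(b - i) makes the recurrence
-- real, since (1 + ix)ζ + (1 - ix) = κε(b - x) and 4ζ = κ²(b² + 1).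
omit [IsProbabilityMeasure μ] in
theorem IsRecurrenceCoeffs.eval_eq (h : IsRecurrenceCoeffs μ c d) (b ε : ℝ) (hε : ε ^ 2 = 1)
    (n : ℕ) :
    (R μ n).eval ((b + Complex.I) / (b - Complex.I)) = (2 * ε / (b - Complex.I)) ^ n *
      recSolution (fun n => ε * (b - c n)) (fun n => d n * (b ^ 2 + 1)) n := by
  have hb : (b : ℂ) - Complex.I ≠ 0 := fun h => by
    have := congrArg Complex.im h
    simp at this
  have hε' : (ε : ℂ) ^ 2 = 1 := by exact_mod_cast hε
  have key (x : ℝ) : (1 + Complex.I * x) * ((b + Complex.I) / (b - Complex.I)) +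
      (1 - Complex.I * x) = 2 * ε / (b - Complex.I) * ((ε * (b - x) : ℝ) : ℂ) := by
    push_cast
    field_simp
    linear_combination (2 * (x : ℂ)) * Complex.I_sq + (2 * x - 2 * b : ℂ) * hε'
  induction n using Nat.twoStepInduction with
  | zero => simp [h.1, recSolution]
  | one =>
    rw [h.2.1, h.1]
    simp only [mul_one, eval_add, eval_mul, eval_C, eval_X, recSolution, key, pow_one]
  | more n ih1 ih2 =>
    rw [h.add_two]
    simp only [eval_sub, eval_add, eval_mul, eval_C, eval_X, recSolution, key, ih1, ih2]
    have e : (b + Complex.I) / (b - Complex.I) * 4 =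
        (2 * ε / (b - Complex.I)) ^ 2 * (b ^ 2 + 1 : ℝ) := by
      push_cast
      field_simp
      linear_combination (-4 : ℂ) * Complex.I_sq - 4 * (b ^ 2 + 1) * hε'
    push_cast at e ⊢
    linear_combination (-(d (n + 2) : ℂ) * (2 * ε / (b - Complex.I)) ^ n *
      recSolution (fun n => ε * (b - c n)) (fun n => d n * (b ^ 2 + 1)) n) * e

end

/-! ### The weighted form and the sign of the weight -/

section

variable {μ : Measure Circle} [IsProbabilityMeasure μ] {c d : ℕ → ℝ}

/-- A Hermitian form with an orthogonal basis of polynomials of degrees `0, 1, 2, …` is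
semidefinite as soon as it has the right sign on the basis. -/
theorem form_semidefinite {w : C(Circle, ℂ)} (hw : star w = w) {ε : ℝ} {S : ℕ → ℂ[X]}
    (hdeg : ∀ n, (S n).natDegree ≤ n) (hcoeff : ∀ n, (S n).coeff n ≠ 0)
    (horth : ∀ (n : ℕ) (q : ℂ[X]), q.degree < n → form μ w (S n) q = 0)
    (hS : ∀ n, 0 ≤ ε * (form μ w (S n) (S n)).re) (q : ℂ[X]) :
    0 ≤ ε * (form μ w q q).re := by
  suffices H : ∀ N : ℕ, ∀ q : ℂ[X], q.degree < N → 0 ≤ ε * (form μ w q q).re from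
    H (q.natDegree + 1) q (degree_le_natDegree.trans_lt (by exact_mod_cast Nat.lt_succ_self _))
  intro N
  induction N with
  | zero =>
    intro q hq
    have : q = 0 := by
      rw [← degree_eq_bot]
      exact Nat.WithBot.lt_zero_iff.1 (by exact_mod_cast hq)
    simp [this, form]
  | succ N ih =>
    intro q hq
    set a := q.coeff N / (S N).coeff N with ha
    have h1 := degree_sub_C_mul_lt hq (hdeg N) (a := a) (by rw [ha, div_mul_cancel₀ _ (hcoeff N)])
    have h2 := horth N _ h1
    have h3 : form μ w (q - C a * S N) (S N) = 0 := by rw [← form_conj hw, h2, map_zero]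
    have h4 := ih _ h1
    -- Pythagoras: q splits into a multiple of S_N and a remainder of lower degree, orthogonal to
    -- S_N.
    have h5 : form μ w q q = (Complex.normSq a : ℂ) * form μ w (S N) (S N) +
        form μ w (q - C a * S N) (q - C a * S N) := by
      rw [form_sub_right, form_C_mul_right] at h2
      rw [form_sub_left, form_C_mul_left] at h3
      rw [form_sub_left, form_sub_right, form_sub_right, form_C_mul_left, form_C_mul_left,
        form_C_mul_right, form_C_mul_right, ← Complex.mul_conj]
      linear_combination a * h2 + conj a * h3
    rw [h5, Complex.add_re, Complex.re_ofReal_mul]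
    have := mul_nonneg (Complex.normSq_nonneg a) (hS N)
    linarith

/-- The weight `2 (b (1 - cos θ) - sin θ)`. -/
def weight (b : ℝ) : C(Circle, ℂ) :=
  (2 * b : ℂ) • 1 - (b : ℂ) • (coord + star coord) + Complex.I • (coord - star coord)

theorem star_weight (b : ℝ) : star (weight b) = weight b := by
  ext z
  simp [weight]
  ring

theorem weight_apply (b : ℝ) (z : Circle) :
    weight b z = ((2 * (b * (1 - (z : ℂ).re) - (z : ℂ).im) : ℝ) : ℂ) := by
  apply Complex.ext <;> simp [weight]
  all_goals ring

theorem weight_eq (b : ℝ) :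
    weight b = star coord * ev (C (Complex.I - b) *
      ((X - C 1) * (X - C ((b + Complex.I) / (b - Complex.I))))) := by
  have hb : (b : ℂ) - Complex.I ≠ 0 := fun h => by
    have := congrArg Complex.im h
    simp at this
  ext z
  have hz := DFunLike.congr_fun coord_mul_star z
  simp [weight] at hz ⊢
  field_simp
  linear_combination (b - Complex.I) * ((z : ℂ) * (b - Complex.I) - 2 * b) * hz

theorem form_weight (b : ℝ) (p q : ℂ[X]) :
    form μ (weight b) p q = (Complex.I - b) *
      form μ 1 ((X - C 1) * ((X - C ((b + Complex.I) / (b - Complex.I))) * p)) (X * q) := by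
  rw [← form_C_mul_left, form, form, weight_eq, map_mul ev, map_mul ev, map_mul ev, map_mul ev,
    map_mul ev, map_mul ev, star_mul, ev_X]
  congr 1
  ring

/-- The factor z - ζ of the weight cancels the division in S_n, and z - 1 brings in the
orthogonality of (z - 1)R_n, so S_0, S_1, … diagonalize the form. -/
theorem form_weight_semidefinite (hμ : Nontrivial μ) (h : IsRecurrenceCoeffs μ c d)
    (hd : ∀ n, 0 < d (n + 2)) {b ε : ℝ} (hε : ε ^ 2 = 1)
    (hV : ∀ n, 0 < recSolution (fun n => ε * (b - c n)) (fun n => d n * (b ^ 2 + 1)) n)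
    (q : ℂ[X]) : 0 ≤ ε * (form μ (weight b) q q).re := by
  set V := recSolution (fun n => ε * (b - c n)) (fun n => d n * (b ^ 2 + 1)) with hVdef
  have hb : (b : ℂ) - Complex.I ≠ 0 := fun h => by
    have := congrArg Complex.im h
    simp at this
  have hε' : (ε : ℂ) ≠ 0 := by
    rintro h
    rw [Complex.ofReal_eq_zero] at h
    simp [h] at hε
  set ζ : ℂ := (b + Complex.I) / (b - Complex.I) with hζ
  set κ : ℂ := 2 * ε / (b - Complex.I) with hκ
  have hκ0 : κ ≠ 0 := by simp [hκ, hb, hε']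
  have hR (n : ℕ) : (R μ n).eval ζ = κ ^ n * V n := h.eval_eq b ε hε n
  set T : ℕ → ℂ[X] := fun n => R μ (n + 1) - C (κ * (V (n + 1) / V n)) * R μ n with hT
  have hroot (n : ℕ) : (X - C ζ) * (T n /ₘ (X - C ζ)) = T n := by
    have := (hV n).ne'
    have h0 : (V n : ℂ) ≠ 0 := by exact_mod_cast this
    rw [mul_divByMonic_eq_iff_isRoot, IsRoot, hT, eval_sub, eval_mul, eval_C, hR, hR]
    field_simp
    ring
  have hTdeg (n : ℕ) : (T n).natDegree ≤ n + 1 := by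
    refine (natDegree_sub_le _ _).trans (max_le (h.degree_coeff _).1 ?_)
    exact (natDegree_C_mul_le _ _).trans ((h.degree_coeff n).1.trans (Nat.le_succ n))
  have hTcoeff (n : ℕ) : (T n).coeff (n + 1) = (R μ (n + 1)).coeff (n + 1) := by
    rw [hT, coeff_sub, coeff_C_mul, coeff_eq_zero_of_natDegree_lt
      (Nat.lt_succ_of_le (h.degree_coeff n).1), mul_zero, sub_zero]
  set S : ℕ → ℂ[X] := fun n => T n /ₘ (X - C ζ) with hSdef
  have hSdeg (n : ℕ) : (S n).natDegree ≤ n := by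
    rw [hSdef, natDegree_divByMonic _ (monic_X_sub_C ζ), natDegree_X_sub_C]
    have := hTdeg n
    lia
  have hScoeff (n : ℕ) : (S n).coeff n = (R μ (n + 1)).coeff (n + 1) := by
    rw [← hTcoeff, ← hroot, sub_mul, coeff_sub, coeff_X_mul, coeff_C_mul,
      coeff_eq_zero_of_natDegree_lt (Nat.lt_succ_of_le (hSdeg n)), mul_zero, sub_zero]
  have hform (n k : ℕ) : form μ (weight b) (S n) (X ^ k) = (Complex.I - b) *
      (form μ 1 ((X - C 1) * R μ (n + 1)) (X ^ (k + 1)) -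
        κ * (V (n + 1) / V n) * form μ 1 ((X - C 1) * R μ n) (X ^ (k + 1))) := by
    rw [form_weight, hroot, ← pow_succ', hT, mul_sub, mul_left_comm, form_sub_left,
      form_C_mul_left]
  have horth (n : ℕ) (q : ℂ[X]) (hq : q.degree < n) : form μ (weight b) (S n) q = 0 := by
    refine form_eq_zero_of_degree_lt (Φ := fun k => X ^ k) (fun k => natDegree_X_pow_le k)
      (fun k => by simp) (fun k hk => ?_) hq
    rw [hform, form_X_sub_one_mul_R hμ hk, form_X_sub_one_mul_R hμ (hk.trans n.lt_succ_self)]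
    simp
  have hpos (n : ℕ) : ∃ r : ℝ, 0 < r ∧
      form μ (weight b) (S n) (S n) = ((2 * ε * (V (n + 1) / V n) * r : ℝ) : ℂ) := by
    obtain ⟨r, hr, hr'⟩ := h.exists_pos hμ hd n
    refine ⟨r, hr, ?_⟩
    -- S_n may be replaced by its leading term in the second slot; there the R_{n+1} contribution
    -- vanishes and that of R_n is the positive moment r.
    have h1 := horth n _ (degree_sub_C_mul_lt (p := X ^ n) (a := (S n).coeff n)
      (degree_le_natDegree.trans_lt (by exact_mod_cast Nat.lt_succ_of_le (hSdeg n)))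
      (natDegree_X_pow_le n) (by simp))
    rw [form_sub_right, form_C_mul_right, hform, form_X_sub_one_mul_R hμ n.lt_succ_self,
      hScoeff] at h1
    have h2 : κ * (b - Complex.I) = 2 * ε := by rw [hκ, div_mul_cancel₀ _ hb]
    push_cast
    linear_combination h1 + κ * (b - Complex.I) * (V (n + 1) / V n) * hr' +
      (V (n + 1) / V n) * r * h2
  refine form_semidefinite (star_weight b) hSdeg (fun n h0 => ?_) horth (fun n => ?_) q
  · obtain ⟨r, hr, hr'⟩ := h.exists_pos hμ hd n
    rw [← hScoeff, h0, map_zero, zero_mul] at hr'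
    exact hr.ne (by exact_mod_cast hr')
  · obtain ⟨r, hr, hr'⟩ := hpos n
    rw [hr', Complex.ofReal_re]
    have h1 := div_pos (hV (n + 1)) (hV n)
    have : ε * (2 * ε * (V (n + 1) / V n) * r) = 2 * (V (n + 1) / V n) * r := by
      linear_combination (2 * (V (n + 1) / V n) * r) * hε
    rw [this]
    positivity

/-- The Laurent polynomials on the circle. -/
def laurent : StarSubalgebra ℂ C(Circle, ℂ) where
  carrier := {f | ∃ (N : ℕ) (p : ℂ[X]), coord ^ N * f = ev p}
  mul_mem' := by
    rintro f g ⟨N, p, hp⟩ ⟨M, q, hq⟩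
    exact ⟨N + M, p * q, by rw [map_mul, ← hp, ← hq]; ring⟩
  add_mem' := by
    rintro f g ⟨N, p, hp⟩ ⟨M, q, hq⟩
    refine ⟨N + M, X ^ M * p + X ^ N * q, ?_⟩
    rw [map_add, map_mul, map_mul, ← hp, ← hq, map_pow, map_pow, ev_X]
    ring
  algebraMap_mem' a := ⟨0, C a, by simp [ev_C]⟩
  star_mem' := by
    rintro f ⟨N, p, hp⟩
    refine ⟨p.natDegree, X ^ N * (p.map (starRingEnd ℂ)).reflect p.natDegree, ?_⟩
    rw [map_mul, ev_reflect le_rfl, ← hp, star_mul, star_pow, map_pow, ev_X]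
    linear_combination (-(coord ^ p.natDegree * star f)) * coord_pow_mul_star N

theorem laurent_topologicalClosure : laurent.topologicalClosure = ⊤ := by
  refine ContinuousMap.starSubalgebra_topologicalClosure_eq_top_of_separatesPoints _ ?_
  intro x y hxy
  exact ⟨coord, ⟨coord, ⟨0, X, by simp⟩, rfl⟩, fun h => hxy (Circle.ext h)⟩

/-- A weight for which the form is nonnegative on polynomials is nonnegative almost everywhere. -/
theorem measure_weight_neg_eq_zero {w : C(Circle, ℝ)} {W : C(Circle, ℂ)}
    (hW : ∀ z, W z = (w z : ℂ)) (h : ∀ q : ℂ[X], 0 ≤ (form μ W q q).re) :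
    μ {z | w z < 0} = 0 := by
  -- A Laurent polynomial becomes a polynomial after multiplication by the unimodular z^N, which
  -- leaves |f|² unchanged; density and continuity do the rest.
  have h1 (f : C(Circle, ℂ)) : 0 ≤ (functional μ (W * f * star f)).re := by
    have hcont : Continuous fun f : C(Circle, ℂ) => (functional μ (W * f * star f)).re := by
      have : Continuous (functional μ) :=
        AddMonoidHomClass.continuous_of_bound (functional μ) 1 fun f => by
          simpa [functional_apply] using norm_integral_le_of_norm_le_const (μ := μ)
            (Filter.Eventually.of_forall f.norm_coe_le_norm)
      fun_prop
    have hcl : IsClosed {f : C(Circle, ℂ) | 0 ≤ (functional μ (W * f * star f)).re} :=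
      isClosed_le continuous_const hcont
    have hsub : (laurent : Set C(Circle, ℂ)) ⊆
        {f : C(Circle, ℂ) | 0 ≤ (functional μ (W * f * star f)).re} := by
      rintro f ⟨N, p, hp⟩
      have := h p
      rw [form, ← hp, star_mul, star_pow] at this
      have e : W * f * star f = W * (coord ^ N * f) * (star f * star coord ^ N) := by
        linear_combination (-(W * f * star f)) * coord_pow_mul_star N
      change 0 ≤ (functional μ (W * f * star f)).re
      rwa [e]
    have : f ∈ laurent.topologicalClosure := by
      rw [laurent_topologicalClosure]; trivial
    exact closure_minimal hsub hcl this
  -- With f the square root of the negative part w⁻, the product w|f|² is -(w⁻)².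
  set f : C(Circle, ℂ) := ⟨fun z => ((√(max (-w z) 0) : ℝ) : ℂ), by fun_prop⟩ with hf
  have h2 := h1 f
  have hcont : Continuous fun z => max (-w z) 0 ^ 2 := by fun_prop
  have h3 : functional μ (W * f * star f) = ((-∫ z, max (-w z) 0 ^ 2 ∂μ : ℝ) : ℂ) := by
    rw [functional_apply, ← integral_neg, ← integral_complex_ofReal]
    congr 1
    ext z
    have hs := Real.mul_self_sqrt (le_max_right (-w z) 0)
    simp only [ContinuousMap.mul_apply, hW, hf, ContinuousMap.coe_mk, ContinuousMap.star_apply]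
    rw [mul_assoc]
    change _ * (_ * conj _) = _
    rw [Complex.conj_ofReal, ← Complex.ofReal_mul, ← Complex.ofReal_mul, hs]
    congr 1
    rcases le_total (-w z) 0 with h0 | h0
    · simp [h0]
    · rw [max_eq_left h0]; ring
  rw [h3, Complex.ofReal_re] at h2
  have h4 : ∫ z, max (-w z) 0 ^ 2 ∂μ = 0 :=
    le_antisymm (by linarith) (integral_nonneg fun z => by positivity)
  have h5 := (integral_eq_zero_iff_of_nonneg (fun z => by positivity)
    (hcont.integrable_of_hasCompactSupport (HasCompactSupport.of_compactSpace _))).1 h4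
  rw [measure_eq_zero_iff_ae_notMem]
  filter_upwards [h5] with z hz hz2
  have hz1 : max (-w z) 0 = 0 := by simpa using hz
  have := le_max_left (-w z) 0
  have hz3 : w z < 0 := hz2
  linarith

end

/-! ### The roots u⁽±⁾ and the null arcs -/

section

/-- The polynomial equals (u - a)(u - b) - q(u² + 1): it is nonnegative to the right of its larger
root (of its only root when q = 1) and negative at u = a and u = b, so both lie strictly to the left
of M. -/
theorem uPlus_le {a b q M : ℝ} (h0 : 0 < q) (h1 : q ≤ 1) (h : uPlus a b q ≤ M) :
    a < M ∧ b < M ∧ q * (M ^ 2 + 1) ≤ (M - a) * (M - b) := by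
  rcases h1.eq_or_lt with rfl | h1
  · by_cases hab : 0 ≤ a + b
    · simp [uPlus, hab] at h
    · rw [uPlus, if_pos rfl, if_neg hab, EReal.coe_le_coe_iff, div_le_iff_of_neg (not_le.1 hab)] at h
      refine ⟨?_, ?_, by nlinarith⟩ <;> by_contra! hM <;> nlinarith [sq_nonneg a, sq_nonneg b]
  · rw [uPlus, if_neg h1.ne, EReal.coe_le_coe_iff] at h
    have hf := fun u => quadratic_factor a b q u h0.le h1
    have hle : (a + b - √(discr a b q)) / (2 * (1 - q)) ≤ (a + b + √(discr a b q)) / (2 * (1 - q)) := by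
      have := Real.sqrt_nonneg (discr a b q)
      gcongr <;> linarith
    generalize (a + b + √(discr a b q)) / (2 * (1 - q)) = u at *
    generalize (a + b - √(discr a b q)) / (2 * (1 - q)) = v at *
    have hpos (x : ℝ) (hx : u ≤ x) : q * (x ^ 2 + 1) ≤ (x - a) * (x - b) := by
      have := mul_nonneg (mul_nonneg (sub_pos.2 h1).le (sub_nonneg.2 (hle.trans hx)))
        (sub_nonneg.2 hx)
      rw [← hf] at this
      linarith
    refine ⟨?_, ?_, hpos M h⟩
    · by_contra! hM
      nlinarith [hpos a (h.trans hM), mul_pos h0 (by positivity : 0 < a ^ 2 + 1)]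
    · by_contra! hM
      nlinarith [hpos b (h.trans hM), mul_pos h0 (by positivity : 0 < b ^ 2 + 1)]

theorem uMinus_eq_neg (a b q : ℝ) : uMinus a b q = -uPlus (-a) (-b) q := by
  have hd : discr (-a) (-b) q = discr a b q := by unfold discr; ring
  rw [uMinus, uPlus, hd]
  split_ifs with h1 h2 h3 h3
  · simp
  · linarith
  · linarith
  · rw [← EReal.coe_neg, ← neg_add, div_neg, neg_neg, neg_mul_neg]
  · rw [← EReal.coe_neg, ← neg_div]
    congr 2
    ring

theorem le_uMinus {a b q m : ℝ} (h0 : 0 < q) (h1 : q ≤ 1) (h : (m : EReal) ≤ uMinus a b q) :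
    m < a ∧ m < b ∧ q * (m ^ 2 + 1) ≤ (m - a) * (m - b) := by
  rw [uMinus_eq_neg, EReal.le_neg, ← EReal.coe_neg] at h
  obtain ⟨h2, h3, h4⟩ := uPlus_le h0 h1 h
  exact ⟨by linarith, by linarith, by linarith⟩

theorem bot_lt_uPlus (a b q : ℝ) : ⊥ < uPlus a b q := by
  unfold uPlus
  split_ifs
  · exact bot_lt_top
  · exact EReal.bot_lt_coe _
  · exact EReal.bot_lt_coe _

theorem uMinus_lt_top (a b q : ℝ) : uMinus a b q < ⊤ := by
  unfold uMinus
  split_ifs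
  · exact bot_lt_top
  · exact EReal.coe_lt_top _
  · exact EReal.coe_lt_top _

variable {μ : Measure Circle} [IsProbabilityMeasure μ] {c d q : ℕ → ℝ}

theorem IsRecurrenceCoeffs.measure_eq_zero (hμ : Nontrivial μ) (h : IsRecurrenceCoeffs μ c d)
    (hq : IsScalingSequence q d) {b ε : ℝ} (hε : ε ^ 2 = 1)
    (hb : ∀ n, 1 ≤ n → 0 < ε * (b - c n))
    (hb' : ∀ n, 1 ≤ n → q (n + 1) * (b ^ 2 + 1) ≤ (b - c n) * (b - c (n + 1))) :
    μ {z | ε * (b * (1 - (z : ℂ).re) - (z : ℂ).im) < 0} = 0 := by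
  obtain ⟨hq1, g, hg1, hg2, hg⟩ := hq
  have hg3 (n : ℕ) (hn : 1 ≤ n) : 0 ≤ g n ∧ g n < 1 := by
    rcases hn.eq_or_lt with rfl | hn
    · exact hg1
    · exact ⟨(hg2 n hn).1.le, (hg2 n hn).2⟩
  have hd (n : ℕ) (hn : 1 ≤ n) : d (n + 1) = q (n + 1) * ((1 - g n) * g (n + 1)) := by
    rw [← hg n hn, mul_div_cancel₀ _ (hq1 n hn).1.ne']
  have hdpos (n : ℕ) : 0 < d (n + 2) := by
    rw [hd (n + 1) (by lia)]
    exact mul_pos (hq1 (n + 1) (by lia)).1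
      (mul_pos (sub_pos.2 (hg3 (n + 1) (by lia)).2) (hg2 (n + 2) (by lia)).1)
  -- The parameters g belong to d/q, not to d; the factor q_{n+1} is absorbed by `hb'`.
  have hV := recSolution_pos (e := fun n => d n * (b ^ 2 + 1)) hb hg3 (fun n hn => by
    have h1 := mul_le_mul_of_nonneg_left (hb' n hn)
      (mul_nonneg (sub_pos.2 (hg3 n hn).2).le (hg3 (n + 1) (by lia)).1)
    simp only [hd n hn]
    linear_combination h1 - (1 - g n) * g (n + 1) * (b - c n) * (b - c (n + 1)) * hε)
  have hpos := form_weight_semidefinite hμ h hdpos hε hV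
  refine measure_mono_null (fun z hz => ?_) (measure_weight_neg_eq_zero (μ := μ)
    (w := ⟨fun z => ε * (2 * (b * (1 - (z : ℂ).re) - (z : ℂ).im)), by fun_prop⟩)
    (W := (ε : ℂ) • weight b) (fun z => ?_) (fun p => ?_))
  · have hz' : ε * (b * (1 - (z : ℂ).re) - (z : ℂ).im) < 0 := hz
    change ε * (2 * (b * (1 - (z : ℂ).re) - (z : ℂ).im)) < 0
    linarith
  · rw [ContinuousMap.smul_apply, weight_apply, smul_eq_mul, ← Complex.ofReal_mul]
    rfl
  · have := hpos p
    rwa [← Complex.re_ofReal_mul, ← smul_eq_mul, form, ← map_smul, ← smul_mul_assoc,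
      ← smul_mul_assoc] at this

theorem two_mul_arccot_eq {x : ℝ} : 2 * arccot x = Real.pi - 2 * Real.arctan x := by
  rw [arccot, if_neg (EReal.coe_ne_top x), if_neg (EReal.coe_ne_bot x), EReal.toReal_coe]
  ring

theorem weight_exp (b θ : ℝ) : b * (1 - (Circle.exp θ : ℂ).re) - (Circle.exp θ : ℂ).im =
    2 * Real.sin (θ / 2) * (b * Real.sin (θ / 2) - Real.cos (θ / 2)) := by
  rw [Circle.coe_exp, Complex.exp_ofReal_mul_I_re, Complex.exp_ofReal_mul_I_im]
  have h1 := Real.cos_two_mul (θ / 2)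
  have h2 := Real.sin_two_mul (θ / 2)
  have h3 := Real.sin_sq_add_cos_sq (θ / 2)
  rw [mul_div_cancel₀ θ two_ne_zero] at h1 h2
  rw [h1, h2]
  linear_combination (-2 * b) * h3

theorem weight_exp_neg {b θ : ℝ} (h0 : 0 < θ) (h1 : θ < 2 * arccot b) :
    b * (1 - (Circle.exp θ : ℂ).re) - (Circle.exp θ : ℂ).im < 0 := by
  rw [two_mul_arccot_eq] at h1
  have h2 := Real.neg_pi_div_two_lt_arctan b
  have hs : 0 < Real.sin (θ / 2) := Real.sin_pos_of_pos_of_lt_pi (by linarith) (by linarith)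
  have ht := Real.tan_lt_tan_of_lt_of_lt_pi_div_two h2
    (show Real.pi / 2 - θ / 2 < Real.pi / 2 by linarith) (by linarith)
  rw [Real.tan_arctan, Real.tan_eq_sin_div_cos, Real.sin_pi_div_two_sub, Real.cos_pi_div_two_sub,
    lt_div_iff₀ hs] at ht
  rw [weight_exp]
  exact mul_neg_of_pos_of_neg (by positivity) (by linarith)

theorem weight_exp_pos {b θ : ℝ} (h0 : θ < 2 * Real.pi) (h1 : 2 * arccot b < θ) :
    0 < b * (1 - (Circle.exp θ : ℂ).re) - (Circle.exp θ : ℂ).im := by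
  rw [two_mul_arccot_eq] at h1
  have h2 := Real.arctan_lt_pi_div_two b
  have hs : 0 < Real.sin (θ / 2) := Real.sin_pos_of_pos_of_lt_pi (by linarith) (by linarith)
  have ht := Real.tan_lt_tan_of_lt_of_lt_pi_div_two
    (show -(Real.pi / 2) < Real.pi / 2 - θ / 2 by linarith) h2 (by linarith)
  rw [Real.tan_arctan, Real.tan_eq_sin_div_cos, Real.sin_pi_div_two_sub, Real.cos_pi_div_two_sub,
    div_lt_iff₀ hs] at ht
  rw [weight_exp]
  exact mul_pos (by positivity) (by linarith)

/-- The conditions in `uPlus_le` hold at the supremum itself, so a single value of b handles the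
whole arc and no limit is needed. -/
theorem IsRecurrenceCoeffs.exists_null_of_lt_theta₁ (hμ : Nontrivial μ)
    (h : IsRecurrenceCoeffs μ c d) (hq : IsScalingSequence q d) :
    ∃ A : Set Circle, μ A = 0 ∧ ∀ θ, 0 < θ → θ < theta₁ c q → Circle.exp θ ∈ A := by
  unfold theta₁
  have hle : ∀ n, 1 ≤ n → uPlus (c n) (c (n + 1)) (q (n + 1)) ≤
      ⨆ (n : ℕ) (_ : 1 ≤ n), uPlus (c n) (c (n + 1)) (q (n + 1)) := fun n hn =>
    le_iSup₂ (f := fun (n : ℕ) (_ : 1 ≤ n) => uPlus (c n) (c (n + 1)) (q (n + 1))) n hn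
  generalize (⨆ (n : ℕ) (_ : 1 ≤ n), uPlus (c n) (c (n + 1)) (q (n + 1))) = s at hle ⊢
  induction s with
  | bot => exact absurd (hle 1 le_rfl) (not_le.2 (bot_lt_uPlus _ _ _))
  | top =>
    -- Here ϑ₁ = 0 and the arc is empty.
    refine ⟨∅, measure_empty, fun θ h0 h1 => ?_⟩
    simp only [arccot, if_true, mul_zero] at h1
    exact absurd h1 h0.not_gt
  | coe b =>
    have hb n (hn : 1 ≤ n) := uPlus_le (hq.1 n hn).1 (hq.1 n hn).2 (hle n hn)
    refine ⟨_, h.measure_eq_zero hμ hq (one_pow 2) (b := b)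
      (fun n hn => by rw [one_mul]; exact sub_pos.2 (hb n hn).1) (fun n hn => (hb n hn).2.2),
      fun θ h0 h1 => ?_⟩
    change 1 * _ < (0 : ℝ)
    rw [one_mul]
    exact weight_exp_neg h0 h1

theorem IsRecurrenceCoeffs.exists_null_of_theta₂_lt (hμ : Nontrivial μ)
    (h : IsRecurrenceCoeffs μ c d) (hq : IsScalingSequence q d) :
    ∃ A : Set Circle, μ A = 0 ∧ ∀ θ, θ < 2 * Real.pi → theta₂ c q < θ → Circle.exp θ ∈ A := by
  unfold theta₂
  have hle : ∀ n, 1 ≤ n → (⨅ (n : ℕ) (_ : 1 ≤ n), uMinus (c n) (c (n + 1)) (q (n + 1))) ≤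
      uMinus (c n) (c (n + 1)) (q (n + 1)) := fun n hn =>
    iInf₂_le (f := fun (n : ℕ) (_ : 1 ≤ n) => uMinus (c n) (c (n + 1)) (q (n + 1))) n hn
  generalize (⨅ (n : ℕ) (_ : 1 ≤ n), uMinus (c n) (c (n + 1)) (q (n + 1))) = s at hle ⊢
  induction s with
  | top => exact absurd (hle 1 le_rfl) (not_le.2 (uMinus_lt_top _ _ _))
  | bot =>
    refine ⟨∅, measure_empty, fun θ h0 h1 => ?_⟩
    simp only [arccot, if_true, if_neg bot_ne_top] at h1
    exact absurd h1 h0.not_gt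
  | coe b =>
    have hb n (hn : 1 ≤ n) := le_uMinus (hq.1 n hn).1 (hq.1 n hn).2 (hle n hn)
    refine ⟨_, h.measure_eq_zero hμ hq (b := b) (ε := -1) (by norm_num)
      (fun n hn => by linarith [(hb n hn).1]) (fun n hn => (hb n hn).2.2), fun θ h0 h1 => ?_⟩
    change -1 * _ < (0 : ℝ)
    rw [neg_one_mul, neg_lt_zero]
    exact weight_exp_pos h0 h1

theorem isClosed_closedArc (a b : ℝ) : IsClosed (closedArc a b) := by
  have : closedArc a b = Circle.exp '' Set.Icc a b := by
    ext z
    exact ⟨fun ⟨θ, h1, h2, h3⟩ => ⟨θ, ⟨h1, h2⟩, h3.symm⟩, fun ⟨θ, h1, h3⟩ => ⟨θ, h1.1, h1.2, h3.symm⟩⟩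
  rw [this]
  exact (isCompact_Icc.image Circle.exp.continuous).isClosed

theorem exists_exp_eq {z : Circle} (hz : z ≠ 1) :
    ∃ θ, 0 < θ ∧ θ < 2 * Real.pi ∧ Circle.exp θ = z := by
  have h0 : (z : ℂ).arg ≠ 0 := fun h => hz (Circle.arg_eq_zero.1 h)
  have h1 := Complex.neg_pi_lt_arg (z : ℂ)
  have h2 := Complex.arg_le_pi (z : ℂ)
  have hpi := Real.pi_pos
  rcases h0.lt_or_gt with h | h
  · exact ⟨(z : ℂ).arg + 2 * Real.pi, by linarith, by linarith,
      by rw [Circle.exp_add_two_pi, Circle.exp_arg]⟩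
  · exact ⟨(z : ℂ).arg, h, by linarith, Circle.exp_arg z⟩

/-- Restricted to {z}, μ is exactly the subtracted point mass. -/
theorem sub_dirac_singleton (μ : Measure Circle) [IsProbabilityMeasure μ] (z : Circle) :
    (μ - μ {z} • Measure.dirac z) {z} = 0 := by
  refine Measure.sub_apply_eq_zero_of_restrict_le_restrict ?_ (measurableSet_singleton z)
  rw [← Measure.restrict_singleton, Measure.restrict_restrict (measurableSet_singleton z),
    Set.inter_self]

end

end CircleSupport

end

theorem mainTheorem1 (μ : Measure Circle) [IsProbabilityMeasure μ]
    (hμ : CircleSupport.Nontrivial μ) :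
    (∃ c d : ℕ → ℝ, CircleSupport.IsRecurrenceCoeffs μ c d ∧
      CircleSupport.IsPositiveChainSequence d) ∧
    ∀ c d q : ℕ → ℝ, CircleSupport.IsRecurrenceCoeffs μ c d →
      CircleSupport.IsScalingSequence q d →
      CircleSupport.theta₁ c q < CircleSupport.theta₂ c q →
      (μ - μ {1} • Measure.dirac 1).support ⊆
        CircleSupport.closedArc (CircleSupport.theta₁ c q) (CircleSupport.theta₂ c q) := by
  refine ⟨⟨_, _, CircleSupport.isRecurrenceCoeffs_rec hμ,
    CircleSupport.isPositiveChainSequence_rec hμ⟩, fun c d q h hq _ => ?_⟩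
  obtain ⟨A, hA, hA'⟩ := h.exists_null_of_lt_theta₁ hμ hq
  obtain ⟨B, hB, hB'⟩ := h.exists_null_of_theta₂_lt hμ hq
  -- The arc is closed, so it suffices that its complement is null; that complement is covered by
  -- {1} and the two null sets.
  refine Measure.support_subset_of_isClosed (CircleSupport.isClosed_closedArc _ _) ?_
  have hnull : (μ - μ {1} • Measure.dirac 1 : Measure Circle) ({1} ∪ (A ∪ B)) = 0 :=
    measure_union_null (CircleSupport.sub_dirac_singleton μ 1)
      (Measure.absolutelyContinuous_of_le Measure.sub_le (measure_union_null hA hB))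
  rw [mem_ae_iff]
  refine measure_mono_null (fun z hz => ?_) hnull
  by_cases hz1 : z = 1
  · exact Or.inl hz1
  · obtain ⟨θ, h0, h1, rfl⟩ := CircleSupport.exists_exp_eq hz1
    rcases lt_or_ge θ (CircleSupport.theta₁ c q) with h2 | h2
    · exact Or.inr (Or.inl (hA' θ h0 h2))
    · refine Or.inr (Or.inr (hB' θ h1 ?_))
      by_contra! h3
      exact hz ⟨θ, h2, h3, rfl⟩
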